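/- Let $(\Omega,\mathcal F_T,(\mathcal F_s)_{s=0}^T,\mathbb P)$ be a filtered probability space in discrete time, $t\in\{0,\dots,T\}$, $p\in[1,\infty]$, $\frac1p+\frac1q=1$, and let $L^p_d(\mathcal F_s)$ be the space of (classes of) $\mathcal F_s$-measurable $p$-integrable (essentially bounded if $p=\infty$) random vectors in $\mathbb R^d$, with the norm topology if $p<\infty$ and with $\sigma(L^\infty_d,L^1_d)$ if $p=\infty$; closures and closedness refer to these topologies. $L^p_d(\mathcal F_s)_+$ denotes the elements with a.s. nonnegative components. Let $M_t\subseteq L^p_d(\mathcal F_t)$ be a closed linear subspace with $(M_t)_+:=M_t\cap L^p_d(\mathcal F_t)_+\neq\{0\}$. Put $\mathcal G(M_t;(M_t)_+)=\{D\subseteq M_t: D=\operatorname{cl}\operatorname{co}(D+(M_t)_+)\}$. A function $R_t$ from $L^p_d(\mathcal F_T)$ to the sets $D\subseteq M_t$ with $D=D+(M_t)_+$ is a conditional risk measure if $R_t(X+m)=R_t(X)-m$ for all $X$ and all $m\in M_t$; $R_t(X)\subseteq R_t(Y)$ whenever $Y-X\in L^p_d(\mathcal F_T)_+$; and $\emptyset\ne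 R_t(0)\ne M_t$. It is closed if its graph $\{(X,u):u\in R_t(X)\}$ is closed. It is coherent if $R_t(\lambda X)=\lambda R_t(X)$ for all $X$ and all real $\lambda>0$, and it is convex ($\lambda R_t(X)+(1-\lambda)R_t(Y)\subseteq R_t(\lambda X+(1-\lambda)Y)$ for all $X,Y$ and $\lambda\in[0,1]$) or subadditive ($R_t(X)+R_t(Y)\subseteq R_t(X+Y)$ for all $X,Y$). Its acceptance set is $A_{R_t}=\{X\in L^p_d(\mathcal F_T):0\in R_t(X)\}$, and $A_{R_t}^+=\{Y\in L^q_d(\mathcal F_T):\mathbb E[Y^{\mathsf T}X]\ge 0\ \forall X\in A_{R_t}\}$. Let $\mathcal M_d(\mathbb P)$ be the set of vectors $\mathbb Q=(\mathbb Q_1,\dots,\mathbb Q_d)$ of probability measures on $\mathcal F_T$ with $\mathbb Q_i\ll\mathbb P$. Let $\xi^i_{s+1}=\mathbb E[\frac{d\mathbb Q_i}{d\mathbb P}|\mathcal F_{s+1}]\big/\mathbb E[\frac{d\mathbb Q_i}{d\mathbb P}|\mathcal F_s]$ where the denominator is positive, and $\xi^i_{s+1}=1$ elsewhere; let $\operatorname{diag}(\mathbb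 E[\frac{d\mathbb Q}{d\mathbb P}|\mathcal F_t])^{-1}\frac{d\mathbb Q}{d\mathbb P}$ denote the random vector $\xi^{\mathbb Q}$ with components $\xi^i_{t+1}\cdots\xi^i_T$, and let $\mathbb E^{\mathbb Q}[X|\mathcal F_t]=\mathbb E[\operatorname{diag}(\xi^{\mathbb Q})X|\mathcal F_t]$ (componentwise; conditional expectation of the positive part minus that of the negative part, defined where both are finite and set arbitrarily elsewhere, which does not affect the sets below). Let $\mathcal W_t^q$ be the set of all pairs $(\mathbb Q,w)$ with $\mathbb Q\in\mathcal M_d(\mathbb P)$; $w\in L^q_d(\mathcal F_t)$; $\mathbb E[w^{\mathsf T}u]\ge0$ for all $u\in(M_t)_+$; $\mathbb E[w^{\mathsf T}u]\neq0$ for some $u\in M_t$; and $\operatorname{diag}(w)\,\xi^{\mathbb Q}\in L^q_d(\mathcal F_T)_+$. For such a pair write $$\bigl(\mathbb E^{\mathbb Q}[-X|\mathcal F_t]+G_t(w)\bigr)\cap M_t:=\{u\in M_t:\ \mathbb E[w^{\mathsf T}\mathbb E^{\mathbb Q}[-X|\mathcal F_t]]\le\mathbb E[w^{\mathsf T}u]\}.$$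 If $\mathbb E^{\mathbb Q}[-X|\mathcal F_t]\in L^p_d(\mathcal F_t)$, this is the literal sum with $G_t(w)=\{x\in L^p_d(\mathcal F_t):0\le\mathbb E[w^{\mathsf T}x]\}$, intersected with $M_t$. Let $R_t:L^p_d(\mathcal F_T)\to\mathcal G(M_t;(M_t)_+)$ be a function. Then: 1. $R_t$ is a closed coherent conditional risk measure if and only if there is a nonempty set $\mathcal W_{t,R_t}^q\subseteq\mathcal W_t^q$ such that for all $X\in L^p_d(\mathcal F_T)$ $$R_t(X)=\bigcap_{(\mathbb Q,w)\in\mathcal W_{t,R_t}^q}\bigl(\mathbb E^{\mathbb Q}[-X|\mathcal F_t]+G_t(w)\bigr)\cap M_t.\qquad(*)$$ 2. If $R_t$ is a closed coherent conditional risk measure, then the set $$\mathcal W_{t,R_t}^{q,\max}=\{(\mathbb Q,w)\in\mathcal W_t^q:\ \operatorname{diag}(w)\operatorname{diag}(\mathbb E[\tfrac{d\mathbb Q}{d\mathbb P}|\mathcal F_t])^{-1}\tfrac{d\mathbb Q}{d\mathbb P}\in A_{R_t}^+\}$$ is nonempty and $(*)$ holds with $\mathcal W_{t,R_t}^q$ replaced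 by $\mathcal W_{t,R_t}^{q,\max}$. 3. If $\mathcal W_{t,R_t}^q\subseteq\mathcal W_t^q$ satisfies $(*)$, then $\mathcal W_{t,R_t}^q\subseteq\mathcal W_{t,R_t}^{q,\max}$. -/

import Mathlib

open MeasureTheory Filter Topology
open scoped ENNReal Pointwise

noncomputable section

/-- The space of portfolios: `ℝ^d`, with the Euclidean norm and inner product. -/
abbrev Vec (d : ℕ) : Type := EuclideanSpace ℝ (Fin d)

namespace SetRisk

variable {Ω : Type*} [m0 : MeasurableSpace Ω] {d : ℕ} {p q : ℝ≥0∞}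

/-! ### The spaces `L^p_d` and their topologies -/

/-- `E[Yᵀ X]`. -/
def pairing (μ : Measure Ω) (Y X : Ω → Vec d) : ℝ := ∫ ω, inner ℝ (Y ω) (X ω) ∂μ

/-- The linear space `L^p_d(F_t)`, as a subspace of `L^p_d` of the whole `σ`-algebra. -/
abbrev LpSub (μ : Measure Ω) (F : Filtration ℕ m0) (d : ℕ) (p : ℝ≥0∞) (t : ℕ) :
    Submodule ℝ (Lp (Vec d) p μ) :=
  lpMeas (Vec d) ℝ (F t) p μ

/-- The cone `L^p_d(F_T)_+` of the random vectors with nonnegative components. -/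
def LpPos (μ : Measure Ω) (d : ℕ) (p : ℝ≥0∞) : Set (Lp (Vec d) p μ) :=
  {X | ∀ᵐ ω ∂μ, ∀ i, 0 ≤ X ω i}

/-- The topology of `L^p_d` used for closedness: the norm topology for `p < ∞`, and the weak
topology `σ(L^∞_d, L^1_d)` for `p = ∞`, that is, the coarsest one for which all the maps
`X ↦ E[Yᵀ X]` with `Y ∈ L^1_d` are continuous. Subspaces carry the induced topology; for
`L^∞_d(F_t)` this is `σ(L^∞_d(F_t), L^1_d(F_t))`, as one sees by replacing `Y` by `E[Y | F_t]`. -/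
@[reducible] def LpTop (μ : Measure Ω) (d : ℕ) (p : ℝ≥0∞) [Fact (1 ≤ p)] :
    TopologicalSpace (Lp (Vec d) p μ) :=
  open scoped Classical in
  if p = ∞ then
    TopologicalSpace.induced
      (fun (X : Lp (Vec d) p μ) (Y : Lp (Vec d) 1 μ) => pairing μ Y X) inferInstance
  else inferInstance

/-! ### Set-valued conditional risk measures -/

section RiskMeasures

variable {μ : Measure Ω}

/-- `(M_t)_+`. -/
def posPart (M : Submodule ℝ (Lp (Vec d) p μ)) : Set (Lp (Vec d) p μ) :=
  (M : Set (Lp (Vec d) p μ)) ∩ LpPos μ d p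

/-- `P(M_t; (M_t)_+) = {D ⊆ M_t : D = D + (M_t)_+}`. -/
def UpperSets (M : Submodule ℝ (Lp (Vec d) p μ)) : Set (Set (Lp (Vec d) p μ)) :=
  {D | D ⊆ M ∧ D = D + posPart M}

/-- `G(M_t; (M_t)_+) = {D ⊆ M_t : D = cl co (D + (M_t)_+)}`. -/
def ClosedConvexUpperSets [Fact (1 ≤ p)] (M : Submodule ℝ (Lp (Vec d) p μ)) :
    Set (Set (Lp (Vec d) p μ)) :=
  {D | D ⊆ M ∧ D = @closure _ (LpTop μ d p) (convexHull ℝ (D + posPart M))}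

/-- `R` is a conditional risk measure with space `M` of eligible portfolios. -/
structure IsCondRiskMeasure (M : Submodule ℝ (Lp (Vec d) p μ))
    (R : Lp (Vec d) p μ → Set (Lp (Vec d) p μ)) : Prop where
  mem_upperSets : ∀ X, R X ∈ UpperSets M
  translative : ∀ X, ∀ m ∈ M, R (X + m) = (fun u => u - m) '' R X
  monotone : ∀ X Y, Y - X ∈ LpPos μ d p → R X ⊆ R Y
  nonempty_zero : (R 0).Nonempty
  zero_ne : R 0 ≠ M

def IsConvexRM (R : Lp (Vec d) p μ → Set (Lp (Vec d) p μ)) : Prop :=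
  ∀ X Y, ∀ l : ℝ, 0 ≤ l → l ≤ 1 → l • R X + (1 - l) • R Y ⊆ R (l • X + (1 - l) • Y)

def IsPosHomRM (R : Lp (Vec d) p μ → Set (Lp (Vec d) p μ)) : Prop :=
  ∀ X, ∀ l : ℝ, 0 < l → R (l • X) = l • R X

def IsSubadditiveRM (R : Lp (Vec d) p μ → Set (Lp (Vec d) p μ)) : Prop :=
  ∀ X Y, R X + R Y ⊆ R (X + Y)

def IsCoherentRM (R : Lp (Vec d) p μ → Set (Lp (Vec d) p μ)) : Prop :=
  (IsConvexRM R ∧ IsPosHomRM R) ∨ (IsSubadditiveRM R ∧ IsPosHomRM R)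

/-- The graph of `R` is closed, for the product topology. -/
def IsClosedRM [Fact (1 ≤ p)] (R : Lp (Vec d) p μ → Set (Lp (Vec d) p μ)) : Prop :=
  @IsClosed _ (@instTopologicalSpaceProd _ _ (LpTop μ d p) (LpTop μ d p))
    {z : Lp (Vec d) p μ × Lp (Vec d) p μ | z.2 ∈ R z.1}

def IsClosedCoherentCondRiskMeasure [Fact (1 ≤ p)] (M : Submodule ℝ (Lp (Vec d) p μ))
    (R : Lp (Vec d) p μ → Set (Lp (Vec d) p μ)) : Prop :=
  IsCondRiskMeasure M R ∧ IsClosedRM R ∧ IsCoherentRM R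

/-- The acceptance set `A_R = {X : 0 ∈ R(X)}`. -/
def acceptanceSet (R : Lp (Vec d) p μ → Set (Lp (Vec d) p μ)) : Set (Lp (Vec d) p μ) :=
  {X | 0 ∈ R X}

/-- The positive dual cone in `L^q_d(F_T)` of a set `A ⊆ L^p_d(F_T)`. -/
def posDual (q : ℝ≥0∞) (A : Set (Lp (Vec d) p μ)) : Set (Lp (Vec d) q μ) :=
  {Y | ∀ X ∈ A, 0 ≤ pairing μ Y X}

/-- `((M_t)_+)^+`, the positive dual cone of `(M_t)_+` in `L^q_d(F_t)`. -/
def posPartDual (F : Filtration ℕ m0) (q : ℝ≥0∞) (t : ℕ) (M : Submodule ℝ (Lp (Vec d) p μ)) :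
    Set (Lp (Vec d) q μ) :=
  {v | v ∈ LpSub μ F d q t ∧ ∀ u ∈ posPart M, 0 ≤ pairing μ v u}

/-- `M_t^⊥`, the annihilator of `M_t` in `L^q_d(F_t)`. -/
def perp (F : Filtration ℕ m0) (q : ℝ≥0∞) (t : ℕ) (M : Submodule ℝ (Lp (Vec d) p μ)) :
    Set (Lp (Vec d) q μ) :=
  {v | v ∈ LpSub μ F d q t ∧ ∀ u ∈ M, pairing μ v u = 0}

/-- The random vector `f` (or rather its almost sure class) is an element of `S ⊆ L^q_d`. -/
def ClassMem (f : Ω → Vec d) (S : Set (Lp (Vec d) q μ)) : Prop :=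
  ∃ Y ∈ S, (Y : Ω → Vec d) =ᵐ[μ] f

end RiskMeasures

/-! ### Vector probability measures and conditional expectations -/

section DualVariables

variable (μ : Measure Ω) (F : Filtration ℕ m0)

/-- The set `M_d(P)` of the vector probability measures with components absolutely continuous with
respect to `P`. -/
def VectorProb (d : ℕ) : Set (Fin d → Measure Ω) :=
  {Q | ∀ i, IsProbabilityMeasure (Q i) ∧ Q i ≪ μ}

/-- `E[dQ_i/dP | F_s]`. -/
def densityProcess (Qi : Measure Ω) (s : ℕ) : Ω → ℝ :=
  μ[fun ω => (Qi.rnDeriv μ ω).toReal | F s]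

/-- The one-step transition density `ξ_{s+1}` of `Q_i`: the quotient of `E[dQ_i/dP | F_{s+1}]` by
`E[dQ_i/dP | F_s]` where the latter is positive, and `1` elsewhere. -/
def transitionDensity (Qi : Measure Ω) (s : ℕ) (ω : Ω) : ℝ :=
  open scoped Classical in
  if 0 < densityProcess μ F Qi s ω then
    densityProcess μ F Qi (s + 1) ω / densityProcess μ F Qi s ω
  else 1

/-- The `i`-th component `ξ_{t+1} ⋯ ξ_T` of `diag(E[dQ/dP | F_t])⁻¹ dQ/dP`. -/
def relDensity (t T : ℕ) (Qi : Measure Ω) (ω : Ω) : ℝ :=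
  ∏ s ∈ Finset.Ico t T, transitionDensity μ F Qi s ω

/-- The random vector `diag(w) diag(E[dQ/dP | F_t])⁻¹ dQ/dP`. -/
def weightedDensity (t T : ℕ) (Q : Fin d → Measure Ω) (w : Ω → Vec d) (ω : Ω) : Vec d :=
  WithLp.toLp 2 fun i => w ω i * relDensity μ F t T (Q i) ω

/-- The conditional expectation `E[f | m]` in the extended sense, `E[f⁺ | m] - E[f⁻ | m]`, where
the conditional expectations of the nonnegative functions `f⁺`, `f⁻` are `[0, ∞]`-valued. It is
the usual one if `f` is integrable. Its value is meaningful wherever both terms are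
finite. -/
def extCondExp (m : MeasurableSpace Ω) (f : Ω → ℝ) (ω : Ω) : ℝ :=
  (condLExp m μ (fun x => ENNReal.ofReal (f x)) ω).toReal -
    (condLExp m μ (fun x => ENNReal.ofReal (-f x)) ω).toReal

/-- The `P`-almost sure version of the `Q`-conditional expectation,
`E^Q[X | F_t] = diag(E[dQ/dP | F_t])⁻¹ E[diag(dQ/dP) X | F_t]`, with `i`-th component
`E[ξ_{t+1} ⋯ ξ_T X_i | F_t]` for the transition densities `ξ_s` of `Q_i`. -/
def condExpQ (t T : ℕ) (Q : Fin d → Measure Ω) (X : Ω → Vec d) (ω : Ω) : Vec d :=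
  WithLp.toLp 2 fun i => extCondExp μ (F t) (fun x => relDensity μ F t T (Q i) x * X x i) ω

variable {μ}

/-- The shifted half-space `(E^Q[X | F_t] + G_t(w)) ∩ M_t`, understood as
`{u ∈ M_t : E[wᵀ E^Q[X | F_t]] ≤ E[wᵀ u]}`, where `G_t(w) = {x : 0 ≤ E[wᵀ x]}`.
If `E^Q[X | F_t]` lies in `L^p_d(F_t)` this is the Minkowski sum intersected with `M_t`. -/
def shiftedHalfspace (t T : ℕ) (M : Submodule ℝ (Lp (Vec d) p μ))
    (Q : Fin d → Measure Ω) (w : Lp (Vec d) q μ) (X : Lp (Vec d) p μ) : Set (Lp (Vec d) p μ) :=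
  {u | u ∈ M ∧ pairing μ w (condExpQ μ F t T Q X) ≤ pairing μ w u}

/-- The set `W_t^q` of the dual variables `(Q, w)`. -/
def dualVars (q : ℝ≥0∞) (t T : ℕ) (M : Submodule ℝ (Lp (Vec d) p μ)) :
    Set ((Fin d → Measure Ω) × Lp (Vec d) q μ) :=
  {z | z.1 ∈ VectorProb μ d ∧ z.2 ∈ posPartDual F q t M \ perp F q t M ∧
    ClassMem (weightedDensity μ F t T z.1 z.2) (LpPos μ d q)}

/-- The set `W_{t,R}^{q,max}` of the pairs in `W_t^q` whose weighted density lies in the positive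
dual cone of the acceptance set of `R`. -/
def maxDualVars (q : ℝ≥0∞) (t T : ℕ) (M : Submodule ℝ (Lp (Vec d) p μ))
    (R : Lp (Vec d) p μ → Set (Lp (Vec d) p μ)) :
    Set ((Fin d → Measure Ω) × Lp (Vec d) q μ) :=
  {z | z ∈ dualVars F q t T M ∧
    ClassMem (weightedDensity μ F t T z.1 z.2) (posDual q (acceptanceSet R))}

/-- `R(X) = ⋂_{(Q, w) ∈ W} (E^Q[-X | F_t] + G_t(w)) ∩ M_t` for all `X`. -/
def IsDualRepresentation (t T : ℕ) (M : Submodule ℝ (Lp (Vec d) p μ))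
    (R : Lp (Vec d) p μ → Set (Lp (Vec d) p μ))
    (W : Set ((Fin d → Measure Ω) × Lp (Vec d) q μ)) : Prop :=
  ∀ X, R X = ⋂ z ∈ W, shiftedHalfspace F t T M z.1 z.2 (-X)

end DualVariables

end SetRisk

end

set_option linter.unusedSectionVars false

noncomputable section
namespace SetRisk

section Pairing

variable {Ω : Type*} [m0 : MeasurableSpace Ω] {d : ℕ} {p q : ℝ≥0∞} {μ : Measure Ω}

/-! ### The pairing between `L^q_d` and `L^p_d` -/

/-! By translativity, `u ∈ R X` means `u ∈ M` and `X + u ∈ acceptanceSet R`. For a closed coherent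
`R` the acceptance set is a closed convex cone containing `L^p_+`. A point outside it is separated
from it by a continuous functional that is nonnegative on the cone, hence on `L^p_+`. Such a
functional is `E[Yᵀ ·]` with `Y` in `L^q` (`exists_pairing_of_positive`), and `Y ≥ 0`. Hence `R X`
consists of the `u ∈ M` with `E[Yᵀ(X + u)] ≥ 0` for all `Y` in the dual cone. The `Y` that vanish on
`M` can be dropped: since `R 0 ≠ M`, some `Y₁` in the dual cone does not vanish on `M`, and `Y + ε
Y₁` replaces `Y` (`eq_polarRM`).

It remains to translate between such `Y` and pairs `(Q, w)` through `Y = diag(w) ξ^Q`. Given `Y`,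
take `w = E[Y | F_t]` and let `Q_i` have density `Y_i / w_i`, read as `1` where `w_i = 0`
(`exists_dualVars`). Since `E[ξ^i | F_t] = 1`, the vectors `w` and `Y` pair equally with
`F_t`-measurable portfolios, and `E[wᵀ E^Q[-X | F_t]] = -E[Yᵀ X]`. The shifted half-space is
therefore `{u ∈ M : E[Yᵀ(X + u)] ≥ 0}` (`mem_shiftedHalfspace_neg`).

Conversely, any family of nonnegative `Y`, at least one of them nonzero on `M`, defines a closed
coherent risk measure in this way (`isClosedCoherent_polarRM`). Maximality is the case `u = 0`. -/

/-- The pairing `(Y, X) ↦ E[Yᵀ X]` as a continuous bilinear map. -/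
def pairingL (μ : Measure Ω) (d : ℕ) (p q : ℝ≥0∞) [Fact (1 ≤ p)] [Fact (1 ≤ q)]
    [ENNReal.HolderConjugate q p] : Lp (Vec d) q μ →L[ℝ] Lp (Vec d) p μ →L[ℝ] ℝ :=
  (innerSL ℝ : Vec d →L[ℝ] Vec d →L[ℝ] ℝ).lpPairing μ q p

variable [Fact (1 ≤ p)] [Fact (1 ≤ q)] [ENNReal.HolderConjugate q p]

theorem pairingL_apply (Y : Lp (Vec d) q μ) (X : Lp (Vec d) p μ) :
    pairingL μ d p q Y X = pairing μ Y X := by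
  rw [pairingL, ContinuousLinearMap.lpPairing_eq_integral]
  rfl

theorem LpTop_of_ne_top (hp : p ≠ ∞) :
    LpTop μ d p = (inferInstance : TopologicalSpace (Lp (Vec d) p μ)) := by
  simp [LpTop, hp]

/-- The pairing of `L^∞_d` with `L^1_d` as a bilinear form. -/
def topPairing (μ : Measure Ω) (d : ℕ) : Lp (Vec d) ∞ μ →ₗ[ℝ] Lp (Vec d) 1 μ →ₗ[ℝ] ℝ :=
  LinearMap.flip ((ContinuousLinearMap.coeLM ℝ).comp (pairingL μ d ∞ 1).toLinearMap)

theorem topPairing_apply (X : Lp (Vec d) ∞ μ) (Y : Lp (Vec d) 1 μ) :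
    topPairing μ d X Y = pairing μ Y X := pairingL_apply Y X

/-- Both sides are the initial topology of the pairings with `L^1_d`; this form gives access to the
theory of weak topologies of bilinear forms. -/
theorem LpTop_top :
    LpTop μ d ∞ = (inferInstance : TopologicalSpace (WeakBilin (topPairing μ d))) := by
  simp only [LpTop, if_true]
  change _ = TopologicalSpace.induced (fun X Y => topPairing μ d X Y) Pi.topologicalSpace
  simp_rw [topPairing_apply]

/-- `LpTop` is a locally convex vector space topology. -/
theorem LpTop_locallyConvex :
    @IsTopologicalAddGroup _ (LpTop μ d p) _ ∧ @ContinuousSMul ℝ _ _ _ (LpTop μ d p) ∧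
      @LocallyConvexSpace ℝ _ _ _ _ _ (LpTop μ d p) := by
  by_cases hp : p = ∞
  · subst hp
    rw [LpTop_top]
    exact ⟨inferInstanceAs (IsTopologicalAddGroup (WeakBilin (topPairing μ d))),
      inferInstanceAs (ContinuousSMul ℝ (WeakBilin (topPairing μ d))),
      inferInstanceAs (LocallyConvexSpace ℝ (WeakBilin (topPairing μ d)))⟩
  · rw [LpTop_of_ne_top hp]
    exact ⟨inferInstance, inferInstance, inferInstance⟩

theorem continuous_pairing (Y : Lp (Vec d) q μ) :
    @Continuous _ _ (LpTop μ d p) _ (fun X : Lp (Vec d) p μ => pairing μ Y X) := by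
  by_cases hp : p = ∞
  · subst hp
    obtain rfl : q = 1 := by
      simpa using ENNReal.HolderConjugate.inv_add_inv_eq_one q ∞
    rw [LpTop_top]
    have h : (fun X : Lp (Vec d) ∞ μ => pairing μ Y X) = fun X => topPairing μ d X Y :=
      funext fun X => (topPairing_apply X Y).symm
    rw [h]
    exact WeakBilin.eval_continuous (topPairing μ d) Y
  · rw [LpTop_of_ne_top hp]
    have h : (fun X : Lp (Vec d) p μ => pairing μ Y X) = pairingL μ d p q Y :=
      funext fun X => (pairingL_apply Y X).symm
    rw [h]
    exact (pairingL μ d p q Y).continuous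

/-- The topological dual of a weak topology `σ(E, F)` is the image of `F`. -/
theorem exists_pairing_of_continuous_top (φ : Lp (Vec d) ∞ μ →ₗ[ℝ] ℝ)
    (hφ : @Continuous _ _ (LpTop μ d ∞) _ φ) :
    ∃ Y : Lp (Vec d) 1 μ, ∀ X, φ X = pairing μ Y X := by
  rw [LpTop_top] at hφ
  obtain ⟨Y, hY⟩ := LinearMap.dualEmbedding_surjective (topPairing μ d)
    (⟨φ, hφ⟩ : StrongDual ℝ (WeakBilin (topPairing μ d)))
  refine ⟨Y, fun X => ?_⟩
  rw [← topPairing_apply]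
  exact (DFunLike.congr_fun hY X).symm

end Pairing

/-! ### Positive functionals on `L^p` -/

section Riesz

variable {Ω : Type*} [m0 : MeasurableSpace Ω] {p q : ℝ≥0∞} {μ : Measure Ω} [IsFiniteMeasure μ]
  [Fact (1 ≤ p)]

/-- The partial sums are indicators of finite unions, and the measure of what they miss tends to
`0`; for `p < ∞` this gives convergence in norm. It makes `E ↦ φ(1_E)` countably additive. -/
theorem hasSum_indicatorConstLp (hp : p ≠ ∞) {f : ℕ → Set Ω} (hf : ∀ i, MeasurableSet (f i))
    (hd : Pairwise (Function.onFun Disjoint f)) :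
    HasSum (fun i => indicatorConstLp p (hf i) (measure_ne_top μ _) (1 : ℝ))
      (indicatorConstLp p (MeasurableSet.iUnion hf) (measure_ne_top μ _) (1 : ℝ)) := by
  have hU : ∀ s : Finset ℕ, MeasurableSet (⋃ i ∈ s, f i) := fun s =>
    s.measurableSet_biUnion fun i _ => hf i
  have hsum : ∀ s : Finset ℕ, ∑ i ∈ s, indicatorConstLp p (hf i) (measure_ne_top μ _) (1 : ℝ)
      = indicatorConstLp p (hU s) (measure_ne_top μ _) (1 : ℝ) := by
    intro s
    induction s using Finset.induction_on with
    | empty => simp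
    | insert a s ha ih =>
      rw [Finset.sum_insert ha, ih]
      have hdis : Disjoint (f a) (⋃ i ∈ s, f i) := by
        rw [Set.disjoint_iUnion₂_right]
        exact fun i hi => hd (fun h => ha (h ▸ hi))
      rw [← indicatorConstLp_disjoint_union (hf a) (hU s) (measure_ne_top μ _)
        (measure_ne_top μ _) hdis]
      congr 1
      rw [Finset.set_biUnion_insert]
  unfold HasSum
  simp_rw [hsum]
  refine tendsto_indicatorConstLp_set hp ?_
  have hsd : ∀ s : Finset ℕ, symmDiff (⋃ i ∈ s, f i) (⋃ i, f i) = (⋃ i, f i) \ ⋃ i ∈ s, f i := by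
    intro s
    rw [symmDiff_def, Set.sdiff_eq_empty.2 (Set.iUnion₂_subset_iUnion _ _)]
    exact Set.empty_union _
  have hms : ∀ s : Finset ℕ, μ (symmDiff (⋃ i ∈ s, f i) (⋃ i, f i))
      = μ (⋃ i, f i) - ∑ i ∈ s, μ (f i) := by
    intro s
    rw [hsd, measure_sdiff (Set.iUnion₂_subset_iUnion _ _) (hU s).nullMeasurableSet
      (measure_ne_top μ _), measure_biUnion_finset (fun i _ j _ hij => hd hij) fun i _ => hf i]
  simp_rw [hms]
  have hs : Tendsto (fun s : Finset ℕ => ∑ i ∈ s, μ (f i)) atTop (𝓝 (μ (⋃ i, f i))) := by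
    rw [measure_iUnion hd hf]
    exact ENNReal.summable.hasSum
  simpa using ENNReal.Tendsto.sub (tendsto_const_nhds (x := μ (⋃ i, f i))) hs
    (Or.inl (measure_ne_top μ _))

/-- The signed measure `E ↦ φ(1_E)` of a continuous functional `φ` on `L^p`, `p < ∞`. -/
def functionalMeasure (hp : p ≠ ∞) (φ : Lp ℝ p μ →L[ℝ] ℝ) : SignedMeasure Ω where
  measureOf' E := open scoped Classical in
    if hE : MeasurableSet E then φ (indicatorConstLp p hE (measure_ne_top μ _) 1) else 0
  empty' := by simp
  not_measurable' _ h := dif_neg h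
  m_iUnion' f hf hd := by
    simp only [hf, MeasurableSet.iUnion hf, dif_pos]
    exact (hasSum_indicatorConstLp hp hf hd).mapL φ

theorem functionalMeasure_apply (hp : p ≠ ∞) (φ : Lp ℝ p μ →L[ℝ] ℝ) {E : Set Ω}
    (hE : MeasurableSet E) :
    functionalMeasure hp φ E = φ (indicatorConstLp p hE (measure_ne_top μ _) 1) :=
  dif_pos hE

/-- Radon–Nikodym: on a null set the indicator is `0` in `L^p`, so the signed measure of `φ` is
absolutely continuous. -/
theorem exists_density_of_functional (hp : p ≠ ∞) (φ : Lp ℝ p μ →L[ℝ] ℝ) :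
    ∃ h : Ω → ℝ, Measurable h ∧ Integrable h μ ∧ ∀ E (hE : MeasurableSet E),
      ∫ ω in E, h ω ∂μ = φ (indicatorConstLp p hE (measure_ne_top μ _) 1) := by
  have hac : functionalMeasure hp φ ≪ᵥ μ.toENNRealVectorMeasure := by
    refine VectorMeasure.AbsolutelyContinuous.mk fun E hE h0 => ?_
    rw [Measure.toENNRealVectorMeasure_apply_measurable hE] at h0
    rw [functionalMeasure_apply hp φ hE]
    have : indicatorConstLp p hE (measure_ne_top μ _) (1 : ℝ) = 0 := by
      rw [← norm_eq_zero, norm_indicatorConstLp (zero_lt_one.trans_le Fact.out).ne' hp]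
      have hp0 : p.toReal⁻¹ ≠ 0 :=
        inv_ne_zero (ENNReal.toReal_ne_zero.2 ⟨(zero_lt_one.trans_le Fact.out).ne', hp⟩)
      simp [measureReal_def, h0, Real.zero_rpow hp0]
    rw [this, map_zero]
  refine ⟨(functionalMeasure hp φ).rnDeriv μ, SignedMeasure.measurable_rnDeriv _ _,
    SignedMeasure.integrable_rnDeriv _ _, fun E hE => ?_⟩
  rw [← functionalMeasure_apply hp φ hE]
  conv_rhs => rw [← SignedMeasure.withDensityᵥ_rnDeriv_eq _ μ hac]
  rw [withDensityᵥ_apply (SignedMeasure.integrable_rnDeriv _ _) hE]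

/-- The functional is integration against the density on simple functions. -/
theorem functional_simpleFunc (φ : Lp ℝ p μ →L[ℝ] ℝ) {h : Ω → ℝ} (hi : Integrable h μ)
    (hφ : ∀ E (hE : MeasurableSet E),
      ∫ ω in E, h ω ∂μ = φ (indicatorConstLp p hE (measure_ne_top μ _) 1))
    (s : SimpleFunc Ω ℝ) :
    Integrable (fun ω => s ω * h ω) μ ∧
      ∫ ω, s ω * h ω ∂μ = φ ((s.memLp_of_isFiniteMeasure p μ).toLp s) := by
  induction s using SimpleFunc.induction with
  | @const c E hE =>
    have h1 : (fun ω => (SimpleFunc.piecewise E hE (SimpleFunc.const Ω c)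
        (SimpleFunc.const Ω 0)) ω * h ω) = fun ω => c * E.indicator h ω := by
      ext ω
      by_cases hω : ω ∈ E <;> simp [hω]
    rw [h1]
    refine ⟨(hi.indicator hE).const_mul c, ?_⟩
    rw [integral_const_mul, integral_indicator hE, hφ E hE, ← smul_eq_mul, ← map_smul]
    congr 1
    rw [indicatorConstLp, ← MemLp.toLp_const_smul]
    refine (MemLp.toLp_eq_toLp_iff _ _).2 (Eventually.of_forall fun ω => ?_)
    by_cases hω : ω ∈ E <;> simp [hω]
  | @add f g _ hf hg =>
    have h1 : (fun ω => (f + g) ω * h ω) = fun ω => f ω * h ω + g ω * h ω := by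
      ext ω
      simp [add_mul]
    rw [h1]
    refine ⟨hf.1.add hg.1, ?_⟩
    rw [integral_add hf.1 hg.1, hf.2, hg.2, ← map_add]
    rfl

/-- Test with `g = a^(q-1)`: then `g a = a^q` and `‖g‖_p = I^(1/p)` with `I = ∫ a^q`, so `I ≤ ∫ g h
≤ C I^(1/p)`. Working with a simple minorant `a` of `h` makes `I` finite beforehand, which permits
the division. -/
theorem eLpNorm_le_of_simpleFunc_pairing [ENNReal.HolderConjugate q p] (hp : p ≠ ∞) (hq : q ≠ ∞)
    {a : SimpleFunc Ω ℝ} {h : Ω → ℝ} {C : ℝ} (hC : 0 ≤ C) (ha : ∀ ω, 0 ≤ a ω)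
    (hah : ∀ᵐ ω ∂μ, a ω ≤ h ω)
    (hi : ∀ s : SimpleFunc Ω ℝ, Integrable (fun ω => s ω * h ω) μ)
    (hb : ∀ s : SimpleFunc Ω ℝ, ∫ ω, s ω * h ω ∂μ
      ≤ C * ‖(s.memLp_of_isFiniteMeasure p μ).toLp s‖) :
    eLpNorm a q μ ≤ ENNReal.ofReal C := by
  have hpq : q.toReal.HolderConjugate p.toReal :=
    ENNReal.HolderConjugate.toReal_of_ne_top hq hp
  have hq0 : q ≠ 0 := ENNReal.HolderConjugate.ne_zero q p
  have hp0 : p ≠ 0 := (zero_lt_one.trans_le Fact.out).ne'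
  set I : ℝ := ∫ ω, a ω ^ q.toReal ∂μ with hI
  have hI0 : 0 ≤ I := integral_nonneg fun ω => Real.rpow_nonneg (ha ω) _
  have hna : ∀ ω, ‖a ω‖ = a ω := fun ω => Real.norm_of_nonneg (ha ω)
  rw [(a.memLp_of_isFiniteMeasure q μ).eLpNorm_eq_integral_rpow_norm hq0 hq]
  simp_rw [hna]
  refine ENNReal.ofReal_le_ofReal ?_
  set g : SimpleFunc Ω ℝ := a.map fun x => x ^ (q.toReal - 1) with hg
  have hg' : ∀ ω, g ω = a ω ^ (q.toReal - 1) := fun ω => rfl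
  have hg0 : ∀ ω, 0 ≤ g ω := fun ω => Real.rpow_nonneg (ha ω) _
  have hga : ∀ ω, g ω * a ω = a ω ^ q.toReal := fun ω => by
    rw [hg', mul_comm, ← Real.rpow_one_add' (ha ω) (by simpa using hpq.pos.ne')]
    congr 1
    ring
  have hgn : ‖(g.memLp_of_isFiniteMeasure p μ).toLp g‖ = I ^ p.toReal⁻¹ := by
    rw [Lp.norm_toLp, (g.memLp_of_isFiniteMeasure p μ).eLpNorm_eq_integral_rpow_norm hp0 hp,
      ENNReal.toReal_ofReal (by positivity)]
    congr 2
    ext ω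
    rw [Real.norm_of_nonneg (hg0 ω), hg', ← Real.rpow_mul (ha ω), hpq.sub_one_mul_conj]
  have h1 : I ≤ C * I ^ p.toReal⁻¹ := by
    rw [← hgn]
    refine le_trans ?_ (hb g)
    refine integral_mono_ae ?_ (hi g) ?_
    · exact (SimpleFunc.integrable_of_isFiniteMeasure (a.map fun x => x ^ q.toReal))
    · filter_upwards [hah] with ω hω
      change a ω ^ q.toReal ≤ _
      rw [← hga]
      exact mul_le_mul_of_nonneg_left hω (hg0 ω)
  rcases hI0.eq_or_lt with h0 | h0
  · rw [← hI, ← h0, Real.zero_rpow (inv_ne_zero hpq.pos.ne')]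
    exact hC
  · have h2 : I = I ^ q.toReal⁻¹ * I ^ p.toReal⁻¹ := by
      rw [← Real.rpow_add h0, hpq.inv_add_inv_eq_one, Real.rpow_one]
    have h3 : 0 < I ^ p.toReal⁻¹ := Real.rpow_pos_of_pos h0 _
    nth_rw 1 [h2] at h1
    exact le_of_mul_le_mul_right h1 h3

/-- Simple functions increasing to `h` have `L^q` norm at most `C`; Fatou carries the bound to the
limit. -/
theorem memLp_of_simpleFunc_pairing [ENNReal.HolderConjugate q p] (hp : p ≠ ∞) (hq : q ≠ ∞)
    {h : Ω → ℝ} {C : ℝ} (hC : 0 ≤ C) (hm : Measurable h) (h0 : 0 ≤ᵐ[μ] h)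
    (hi : ∀ s : SimpleFunc Ω ℝ, Integrable (fun ω => s ω * h ω) μ)
    (hb : ∀ s : SimpleFunc Ω ℝ, ∫ ω, s ω * h ω ∂μ
      ≤ C * ‖(s.memLp_of_isFiniteMeasure p μ).toLp s‖) :
    MemLp h q μ := by
  let f : Ω → ℝ≥0∞ := fun ω => ENNReal.ofReal (h ω)
  have hf : Measurable f := hm.ennreal_ofReal
  let a : ℕ → SimpleFunc Ω ℝ := fun n => (SimpleFunc.eapprox f n).map ENNReal.toReal
  have hle : ∀ n ω, SimpleFunc.eapprox f n ω ≤ f ω := fun n ω => by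
    rw [← SimpleFunc.iSup_eapprox_apply hf ω]
    exact le_iSup (fun n => SimpleFunc.eapprox f n ω) n
  have hbound : ∀ n, eLpNorm (a n) q μ ≤ ENNReal.ofReal C := fun n => by
    refine eLpNorm_le_of_simpleFunc_pairing hp hq hC (fun ω => ENNReal.toReal_nonneg) ?_ hi hb
    filter_upwards [h0] with ω hω
    exact ENNReal.toReal_le_of_le_ofReal hω (hle n ω)
  have hlim : ∀ᵐ ω ∂μ, Tendsto (fun n => a n ω) atTop (𝓝 (h ω)) := by
    filter_upwards [h0] with ω hω
    have h1 : Tendsto (fun n => SimpleFunc.eapprox f n ω) atTop (𝓝 (f ω)) := by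
      rw [← SimpleFunc.iSup_eapprox_apply hf ω]
      exact tendsto_atTop_iSup fun i j hij => SimpleFunc.monotone_eapprox f hij ω
    have h2 := (ENNReal.tendsto_toReal (ENNReal.ofReal_ne_top (r := h ω))).comp h1
    rwa [ENNReal.toReal_ofReal hω] at h2
  refine ⟨hm.aestronglyMeasurable, lt_of_le_of_lt ?_ (ENNReal.ofReal_lt_top (r := C))⟩
  refine (Lp.eLpNorm_lim_le_liminf_eLpNorm (fun n => (a n).aestronglyMeasurable) h hlim).trans ?_
  exact (liminf_le_liminf (Eventually.of_forall hbound)).trans (by simp)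

/-- A positive continuous functional on `L^p`, `p < ∞`, is given by an element of `L^q`. -/
theorem exists_memLp_of_positive [ENNReal.HolderConjugate q p] (hp : p ≠ ∞)
    (φ : Lp ℝ p μ →L[ℝ] ℝ) (hpos : ∀ X : Lp ℝ p μ, 0 ≤ᵐ[μ] X → 0 ≤ φ X) :
    ∃ h : Ω → ℝ, MemLp h q μ ∧ ∀ X : Lp ℝ p μ, φ X = ∫ ω, h ω * X ω ∂μ := by
  obtain ⟨h, hm, hint, hφ⟩ := exists_density_of_functional hp φ
  have h0 : 0 ≤ᵐ[μ] h := by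
    refine ae_nonneg_of_forall_setIntegral_nonneg hint fun E hE _ => ?_
    rw [hφ E hE]
    refine hpos _ ?_
    filter_upwards [indicatorConstLp_coeFn (p := p) (hs := hE) (hμs := measure_ne_top μ E)
      (c := (1 : ℝ))] with ω hω
    rw [hω]
    exact Set.indicator_nonneg (fun _ _ => zero_le_one) ω
  have hs := functional_simpleFunc φ hint hφ
  have hb : ∀ s : SimpleFunc Ω ℝ, ∫ ω, s ω * h ω ∂μ
      ≤ ‖φ‖ * ‖(s.memLp_of_isFiniteMeasure p μ).toLp s‖ := fun s => by
    rw [(hs s).2]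
    exact (le_abs_self _).trans (φ.le_opNorm _)
  have hmem : MemLp h q μ := by
    -- For `q = ∞` the test function `a^(q-1)` is not available; instead `∫_E h = φ(1_E) ≤ ‖φ‖ μ(E)`
    -- for all `E` bounds `h` directly.
    by_cases hq : q = ∞
    · subst hq
      obtain rfl : p = 1 := by simpa using ENNReal.HolderConjugate.inv_add_inv_eq_one ∞ p
      have hle : h ≤ᵐ[μ] fun _ => ‖φ‖ := by
        refine ae_le_of_forall_setIntegral_le hint (integrable_const _) fun E hE _ => ?_
        rw [hφ E hE, setIntegral_const, smul_eq_mul, mul_comm]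
        refine (le_abs_self _).trans ((φ.le_opNorm _).trans_eq ?_)
        rw [norm_indicatorConstLp one_ne_zero ENNReal.one_ne_top]
        simp
      refine memLp_top_of_bound hm.aestronglyMeasurable ‖φ‖ ?_
      filter_upwards [hle, h0] with ω h1 h2
      rwa [Real.norm_of_nonneg h2]
    · exact memLp_of_simpleFunc_pairing hp hq (norm_nonneg φ) hm h0 (fun s => (hs s).1) hb
  refine ⟨h, hmem, fun X => ?_⟩
  have : Fact (1 ≤ q) := ⟨ENNReal.HolderConjugate.one_le q p⟩
  let ψ : Lp ℝ p μ →L[ℝ] ℝ := (ContinuousLinearMap.mul ℝ ℝ).lpPairing μ q p (hmem.toLp h)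
  have hψ : ∀ X : Lp ℝ p μ, ψ X = ∫ ω, h ω * X ω ∂μ := fun X => by
    rw [ContinuousLinearMap.lpPairing_eq_integral]
    refine integral_congr_ae ?_
    filter_upwards [hmem.coeFn_toLp] with ω hω
    simp [hω]
  rw [← hψ]
  -- Two continuous functionals that agree on indicators agree on `L^p`, because simple functions
  -- are dense for `p < ∞`.
  refine Lp.induction hp (fun X : Lp ℝ p μ => φ X = ψ X) ?_ ?_ ?_ X
  · intro c E hE hμE
    rw [Lp.simpleFunc.coe_indicatorConst, hψ]
    have h1 : indicatorConstLp p hE hμE.ne c = c • indicatorConstLp p hE hμE.ne (1 : ℝ) := by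
      rw [indicatorConstLp, indicatorConstLp, ← MemLp.toLp_const_smul]
      refine (MemLp.toLp_eq_toLp_iff _ _).2 (Eventually.of_forall fun ω => ?_)
      by_cases hω : ω ∈ E <;> simp [hω]
    conv_lhs => rw [h1, map_smul, ← hφ E hE, smul_eq_mul, ← integral_const_mul,
      ← integral_indicator hE]
    refine integral_congr_ae ?_
    filter_upwards [indicatorConstLp_coeFn (p := p) (hs := hE) (hμs := hμE.ne)
      (c := c)] with ω hω
    rw [hω]
    by_cases hω : ω ∈ E <;> simp [hω, mul_comm]
  · intro f g hf hg _ h1 h2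
    rw [map_add, map_add, h1, h2]
  · exact isClosed_eq φ.continuous ψ.continuous

end Riesz

/-! ### Positive functionals on vector-valued `L^p`. -/

section VectorRiesz

variable {Ω : Type*} [m0 : MeasurableSpace Ω] {d : ℕ} {p q : ℝ≥0∞} {μ : Measure Ω}
  [IsFiniteMeasure μ] [Fact (1 ≤ p)]

theorem vec_inner (x y : Vec d) : inner ℝ x y = ∑ i, x i * y i := by
  simp [PiLp.inner_apply, mul_comm]

/-- Coordinatewise reduction: `φ` composed with the `i`-th coordinate embedding is a positive scalar
functional, and `X` is the sum of its embedded coordinates. -/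
theorem exists_pairing_of_positive_of_ne_top [ENNReal.HolderConjugate q p] (hp : p ≠ ∞)
    (φ : Lp (Vec d) p μ →L[ℝ] ℝ) (hpos : ∀ X ∈ LpPos μ d p, 0 ≤ φ X) :
    ∃ Y : Lp (Vec d) q μ, ∀ X, φ X = pairing μ Y X := by
  let e : Fin d → ℝ →L[ℝ] Vec d := fun i =>
    ContinuousLinearMap.toSpanSingleton ℝ (EuclideanSpace.single i (1 : ℝ))
  let φi : Fin d → Lp ℝ p μ →L[ℝ] ℝ := fun i => φ.comp ((e i).compLpL p μ)
  have he : ∀ i j (x : ℝ), e i x j = if j = i then x else 0 := fun i j x => by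
    simp [e]
  have hφi : ∀ i (X : Lp ℝ p μ), 0 ≤ᵐ[μ] X → 0 ≤ φi i X := by
    intro i X hX
    refine hpos ((e i).compLpL p μ X) ?_
    filter_upwards [(e i).coeFn_compLpL (p := p) X, hX] with ω h1 h2 j
    rw [h1, he]
    split_ifs
    exacts [h2, le_rfl]
  choose h hm hh using fun i => exists_memLp_of_positive (q := q) hp (φi i) (hφi i)
  have hY : MemLp (fun ω => (WithLp.toLp 2 fun i => h i ω : Vec d)) q μ :=
    memLp_piLp_iff.2 hm
  refine ⟨hY.toLp _, fun X => ?_⟩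
  have hXi : ∀ i, ((EuclideanSpace.proj i : Vec d →L[ℝ] ℝ).compLpL p μ X : Ω → ℝ)
      =ᵐ[μ] fun ω => X ω i := fun i =>
    (EuclideanSpace.proj i : Vec d →L[ℝ] ℝ).coeFn_compLpL (p := p) X
  have hX : X = ∑ i, (e i).compLpL p μ ((EuclideanSpace.proj i : Vec d →L[ℝ] ℝ).compLpL p μ X) := by
    refine Lp.ext ?_
    have h1 : ∀ᵐ ω ∂μ, ∀ i, (e i).compLpL p μ
        ((EuclideanSpace.proj i : Vec d →L[ℝ] ℝ).compLpL p μ X) ω = e i (X ω i) := by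
      refine ae_all_iff.2 fun i => ?_
      filter_upwards [(e i).coeFn_compLpL (p := p)
        ((EuclideanSpace.proj i : Vec d →L[ℝ] ℝ).compLpL p μ X), hXi i] with ω h2 h3
      rw [h2, h3]
    filter_upwards [h1, Lp.coeFn_finsetSum Finset.univ fun i => (e i).compLpL p μ
      ((EuclideanSpace.proj i : Vec d →L[ℝ] ℝ).compLpL p μ X)] with ω h2 h3
    rw [h3]
    ext j
    simp [h2, he]
  conv_lhs => rw [hX, map_sum]
  have h4 : ∀ i, φ ((e i).compLpL p μ ((EuclideanSpace.proj i : Vec d →L[ℝ] ℝ).compLpL p μ X))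
      = ∫ ω, h i ω * X ω i ∂μ := fun i => by
    refine (hh i _).trans (integral_congr_ae ?_)
    filter_upwards [hXi i] with ω hω
    rw [hω]
  simp_rw [h4]
  rw [← integral_finsetSum]
  · refine integral_congr_ae ?_
    filter_upwards [hY.coeFn_toLp] with ω hω
    rw [vec_inner, hω]
  · intro i _
    exact MemLp.integrable_mul (hm i) ((Lp.memLp X).eval_piLp i)

/-- A positive functional on `L^p_d` that is continuous for `LpTop` is given by an element of
`L^q_d`. -/
theorem exists_pairing_of_positive [ENNReal.HolderConjugate q p]
    (φ : Lp (Vec d) p μ →ₗ[ℝ] ℝ) (hφ : @Continuous _ _ (LpTop μ d p) _ φ)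
    (hpos : ∀ X ∈ LpPos μ d p, 0 ≤ φ X) :
    ∃ Y : Lp (Vec d) q μ, ∀ X, φ X = pairing μ Y X := by
  by_cases hp : p = ∞
  · subst hp
    obtain rfl : q = 1 := by simpa using ENNReal.HolderConjugate.inv_add_inv_eq_one q ∞
    exact exists_pairing_of_continuous_top φ hφ
  · rw [LpTop_of_ne_top hp] at hφ
    exact exists_pairing_of_positive_of_ne_top hp ⟨φ, hφ⟩ hpos

end VectorRiesz

/-! ### Conditional expectations and densities -/

section Scalar

variable {Ω : Type*} {m m0 : MeasurableSpace Ω} {μ : Measure Ω}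

/-- Nonnegative functions with the same integrals over the sets of `m` have the same integral
against every `m`-measurable nonnegative function. -/
theorem lintegral_mul_congr_of_setLIntegral (hm : m ≤ m0) {f₁ f₂ : Ω → ℝ≥0∞}
    (h₁ : AEMeasurable f₁ μ) (h₂ : AEMeasurable f₂ μ)
    (h : ∀ s, MeasurableSet[m] s → ∫⁻ ω in s, f₁ ω ∂μ = ∫⁻ ω in s, f₂ ω ∂μ)
    {g : Ω → ℝ≥0∞} (hg : Measurable[m] g) :
    ∫⁻ ω, g ω * f₁ ω ∂μ = ∫⁻ ω, g ω * f₂ ω ∂μ := by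
  -- The hypothesis says that the measures with densities `f₁` and `f₂` coincide on `m`, and the
  -- integral of an `m`-measurable function only sees these restrictions.
  have key : (μ.withDensity f₁).trim hm = (μ.withDensity f₂).trim hm := by
    refine @Measure.ext _ m _ _ fun s hs => ?_
    rw [trim_measurableSet_eq hm hs, trim_measurableSet_eq hm hs, withDensity_apply _ (hm s hs),
      withDensity_apply _ (hm s hs), h s hs]
  have hg' : AEMeasurable g μ := (hg.mono hm le_rfl).aemeasurable
  have h3 : ∀ f : Ω → ℝ≥0∞, AEMeasurable f μ →
      ∫⁻ ω, g ω * f ω ∂μ = ∫⁻ ω, g ω ∂((μ.withDensity f).trim hm) := fun f hf => by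
    rw [lintegral_trim hm hg, lintegral_withDensity_eq_lintegral_mul₀ hf hg']
    simp [mul_comm]
  rw [h3 _ h₁, h3 _ h₂, key]

/-- The quotient `f / D`, understood as `1` where `D` is not positive. -/
def quotDensity (f D : Ω → ℝ) (ω : Ω) : ℝ :=
  open scoped Classical in if 0 < D ω then f ω / D ω else 1

theorem measurable_quotDensity {f D : Ω → ℝ} (hf : Measurable f) (hD : Measurable D) :
    Measurable (quotDensity f D) := by
  unfold quotDensity
  exact Measurable.ite (measurableSet_lt measurable_const hD) (hf.div hD) measurable_const

theorem quotDensity_nonneg {f D : Ω → ℝ} (hf0 : 0 ≤ᵐ[μ] f) : 0 ≤ᵐ[μ] quotDensity f D := by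
  filter_upwards [hf0] with ω hω
  unfold quotDensity
  split_ifs with h
  exacts [div_nonneg hω h.le, zero_le_one]

variable [IsProbabilityMeasure μ]

theorem lintegral_mul_condLExp (hm : m ≤ m0) {f : Ω → ℝ≥0∞} (hf : AEMeasurable f μ)
    {g : Ω → ℝ≥0∞} (hg : Measurable[m] g) :
    ∫⁻ ω, g ω * condLExp m μ f ω ∂μ = ∫⁻ ω, g ω * f ω ∂μ :=
  lintegral_mul_congr_of_setLIntegral hm (measurable_condLExp' m μ f).aemeasurable hf
    (fun _ hs => setLIntegral_condLExp hm μ f hs) hg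

theorem lintegral_mul_ofReal_condExp (hm : m ≤ m0) {f D : Ω → ℝ} (hf : Integrable f μ)
    (hf0 : 0 ≤ᵐ[μ] f) (hD : D =ᵐ[μ] μ[f | m]) {g : Ω → ℝ≥0∞} (hg : Measurable[m] g) :
    ∫⁻ ω, g ω * ENNReal.ofReal (D ω) ∂μ = ∫⁻ ω, g ω * ENNReal.ofReal (f ω) ∂μ := by
  have h0 : 0 ≤ᵐ[μ] μ[f | m] := condExp_nonneg hf0
  have h1 : ∫⁻ ω, g ω * ENNReal.ofReal (D ω) ∂μ
      = ∫⁻ ω, g ω * ENNReal.ofReal ((μ[f | m]) ω) ∂μ := by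
    refine lintegral_congr_ae ?_
    filter_upwards [hD] with ω hω
    rw [hω]
  rw [h1]
  refine lintegral_mul_congr_of_setLIntegral hm integrable_condExp.aemeasurable.ennreal_ofReal
    hf.aemeasurable.ennreal_ofReal (fun s hs => ?_) hg
  rw [← ofReal_integral_eq_lintegral_ofReal integrable_condExp.integrableOn
      (ae_restrict_of_ae h0),
    ← ofReal_integral_eq_lintegral_ofReal hf.integrableOn (ae_restrict_of_ae hf0),
    setIntegral_condExp hm hf hs]

/-- This is `E[f / D | m] = 1`. On `{D > 0}` use the `m`-measurable weight `g / D` in the defining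
property of `D = E[f | m]`; elsewhere the quotient is `1` by convention. -/
theorem lintegral_mul_quotDensity (hm : m ≤ m0) {f D : Ω → ℝ} (hf : Integrable f μ)
    (hf0 : 0 ≤ᵐ[μ] f) (hD : D =ᵐ[μ] μ[f | m]) (hDm : Measurable[m] D)
    {g : Ω → ℝ≥0∞} (hg : Measurable[m] g) :
    ∫⁻ ω, g ω * ENNReal.ofReal (quotDensity f D ω) ∂μ = ∫⁻ ω, g ω ∂μ := by
  have hS : MeasurableSet[m] {ω | 0 < D ω} := measurableSet_lt measurable_const hDm
  rw [← lintegral_add_compl _ (hm _ hS), ← lintegral_add_compl g (hm _ hS)]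
  congr 1
  · rw [← lintegral_indicator (hm _ hS), ← lintegral_indicator (hm _ hS)]
    have hk : Measurable[m] ({ω | 0 < D ω}.indicator fun ω => g ω * (ENNReal.ofReal (D ω))⁻¹) :=
      (hg.mul hDm.ennreal_ofReal.inv).indicator hS
    have := lintegral_mul_ofReal_condExp hm hf hf0 hD hk
    rw [lintegral_congr (g := {ω | 0 < D ω}.indicator g)] at this
    · rw [this]
      refine lintegral_congr fun ω => ?_
      by_cases hω : 0 < D ω
      · simp only [Set.indicator, Set.mem_ofPred_eq, hω, if_true, quotDensity]
        rw [ENNReal.ofReal_div_of_pos hω, div_eq_mul_inv, mul_assoc, mul_comm (ENNReal.ofReal _)]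
      · simp [hω]
    · intro ω
      by_cases hω : 0 < D ω
      · simp only [Set.indicator, Set.mem_ofPred_eq, hω, if_true]
        rw [mul_assoc, ENNReal.inv_mul_cancel (by simpa using hω) ENNReal.ofReal_ne_top, mul_one]
      · simp [hω]
  · refine setLIntegral_congr_fun (hm _ hS).compl fun ω hω => ?_
    have : ¬ 0 < D ω := hω
    simp [quotDensity, this]

/-- The convention off `{D > 0}` is harmless: the integrals of `f` and `D` over `{D ≤ 0}` agree and
vanish, so `f = 0` there. -/
theorem mul_quotDensity (hm : m ≤ m0) {f D : Ω → ℝ} (hf : Integrable f μ)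
    (hf0 : 0 ≤ᵐ[μ] f) (hD : D =ᵐ[μ] μ[f | m]) (hDm : Measurable[m] D) :
    (fun ω => D ω * quotDensity f D ω) =ᵐ[μ] f := by
  have hD0 : 0 ≤ᵐ[μ] D := (condExp_nonneg hf0).trans_eq hD.symm
  have hS : MeasurableSet[m] {ω | D ω ≤ 0} := measurableSet_le hDm measurable_const
  have h1 : ∫⁻ ω in {ω | D ω ≤ 0}, ENNReal.ofReal (f ω) ∂μ = 0 := by
    have := lintegral_mul_ofReal_condExp hm hf hf0 hD
      (g := {ω | D ω ≤ 0}.indicator fun _ => 1) (measurable_const.indicator hS)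
    rw [← lintegral_indicator (hm _ hS)]
    calc _ = ∫⁻ ω, {ω | D ω ≤ 0}.indicator (fun _ => 1) ω * ENNReal.ofReal (f ω) ∂μ :=
          lintegral_congr fun ω => by by_cases hω : D ω ≤ 0 <;> simp [hω]
      _ = ∫⁻ ω, {ω | D ω ≤ 0}.indicator (fun _ => 1) ω * ENNReal.ofReal (D ω) ∂μ := this.symm
      _ = 0 := by
          rw [lintegral_congr (g := fun _ => 0), lintegral_zero]
          intro ω
          by_cases hω : D ω ≤ 0 <;> simp [hω]
  rw [lintegral_eq_zero_iff' hf.aemeasurable.ennreal_ofReal.restrict] at h1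
  have h2 := (ae_restrict_iff' (hm _ hS)).1 h1
  filter_upwards [h2, hf0, hD0] with ω h3 h4 h7
  unfold quotDensity
  split_ifs with h
  · field_simp
  · have h5 : f ω ≤ 0 := by simpa using h3 (not_lt.1 h)
    rw [le_antisymm (not_lt.1 h) h7, le_antisymm h5 h4, zero_mul]

end Scalar

/-! ### Density processes and products of transition densities. -/

section Density

variable {Ω : Type*} [m0 : MeasurableSpace Ω] {μ : Measure Ω}
  (F : Filtration ℕ m0) (ν : Measure Ω)

theorem transitionDensity_eq (s : ℕ) :
    transitionDensity μ F ν s =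
      quotDensity (densityProcess μ F ν (s + 1)) (densityProcess μ F ν s) :=
  rfl

theorem measurable_densityProcess (s : ℕ) : Measurable[F s] (densityProcess μ F ν s) :=
  stronglyMeasurable_condExp.measurable

theorem integrable_densityProcess (s : ℕ) : Integrable (densityProcess μ F ν s) μ :=
  integrable_condExp

theorem densityProcess_nonneg (s : ℕ) : 0 ≤ᵐ[μ] densityProcess μ F ν s :=
  condExp_nonneg (Eventually.of_forall fun _ => ENNReal.toReal_nonneg)

theorem densityProcess_tower [IsProbabilityMeasure μ] (s : ℕ) :
    densityProcess μ F ν s =ᵐ[μ] μ[densityProcess μ F ν (s + 1) | F s] :=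
  (condExp_condExp_of_le (F.mono s.le_succ) (F.le _)).symm

theorem measurable_transitionDensity (s : ℕ) :
    Measurable[F (s + 1)] (transitionDensity μ F ν s) :=
  @measurable_quotDensity _ (F (s + 1)) _ _ (measurable_densityProcess F ν (s + 1))
    ((measurable_densityProcess F ν s).mono (F.mono s.le_succ) le_rfl)

theorem transitionDensity_nonneg (s : ℕ) : 0 ≤ᵐ[μ] transitionDensity μ F ν s :=
  quotDensity_nonneg (densityProcess_nonneg F ν (s + 1))

theorem relDensity_succ {t n : ℕ} (h : t ≤ n) (ω : Ω) :
    relDensity μ F t (n + 1) ν ω = relDensity μ F t n ν ω * transitionDensity μ F ν n ω :=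
  Finset.prod_Ico_succ_top h _

theorem relDensity_self (t : ℕ) (ω : Ω) : relDensity μ F t t ν ω = 1 := by
  simp [relDensity]

theorem measurable_relDensity (t n : ℕ) : Measurable[F n] (relDensity μ F t n ν) := by
  unfold relDensity
  refine Finset.measurable_fun_prod _ fun s hs => ?_
  exact (measurable_transitionDensity F ν s).mono (F.mono (Finset.mem_Ico.1 hs).2) le_rfl

theorem relDensity_nonneg (t n : ℕ) : 0 ≤ᵐ[μ] relDensity μ F t n ν := by
  filter_upwards [ae_all_iff.2 fun s => transitionDensity_nonneg (μ := μ) F ν s] with ω h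
  exact Finset.prod_nonneg fun s _ => h s

/-- `E[ξ_{t+1} ⋯ ξ_n | F_t] = 1`. -/
theorem lintegral_mul_relDensity [IsProbabilityMeasure μ] {t n : ℕ} (h : t ≤ n)
    {g : Ω → ℝ≥0∞} (hg : Measurable[F t] g) :
    ∫⁻ ω, g ω * ENNReal.ofReal (relDensity μ F t n ν ω) ∂μ = ∫⁻ ω, g ω ∂μ := by
  induction n, h using Nat.le_induction with
  | base => simp [relDensity_self]
  | succ n h ih =>
    rw [← ih]
    -- The product of the earlier factors is `F n`-measurable, so it joins `g` as a weight and the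
    -- last factor integrates out.
    have hk : Measurable[F n] fun ω => g ω * ENNReal.ofReal (relDensity μ F t n ν ω) :=
      (hg.mono (F.mono h) le_rfl).mul (measurable_relDensity F ν t n).ennreal_ofReal
    rw [← lintegral_mul_quotDensity (F.le n) (integrable_densityProcess F ν (n + 1))
      (densityProcess_nonneg F ν (n + 1)) (densityProcess_tower F ν n)
      (measurable_densityProcess F ν n) hk]
    refine lintegral_congr_ae ?_
    filter_upwards [relDensity_nonneg F ν t n] with ω hω
    rw [relDensity_succ F ν h, ENNReal.ofReal_mul hω, mul_assoc, transitionDensity_eq]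

/-- The density process is recovered from its value at `t` and the transition densities. -/
theorem densityProcess_mul_relDensity [IsProbabilityMeasure μ] {t n : ℕ} (h : t ≤ n) :
    (fun ω => densityProcess μ F ν t ω * relDensity μ F t n ν ω)
      =ᵐ[μ] densityProcess μ F ν n := by
  induction n, h using Nat.le_induction with
  | base => simp [relDensity_self]
  | succ n h ih =>
    filter_upwards [ih, mul_quotDensity (F.le n) (integrable_densityProcess F ν (n + 1))
      (densityProcess_nonneg F ν (n + 1)) (densityProcess_tower F ν n)
      (measurable_densityProcess F ν n)] with ω h1 h2
    rw [relDensity_succ F ν h, ← mul_assoc, h1, transitionDensity_eq]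
    exact h2

end Density

/-! ### Integration against densities with conditional mean one. -/

section Weights

variable {Ω : Type*} {m m0 : MeasurableSpace Ω} {μ : Measure Ω}

/-- A density `ξ` with `E[ξ | m] = 1`. -/
def IsCondDensity (m : MeasurableSpace Ω) {m0 : MeasurableSpace Ω} (μ : Measure Ω) (ξ : Ω → ℝ) :
    Prop :=
  ∀ g : Ω → ℝ≥0∞, Measurable[m] g → ∫⁻ ω, g ω * ENNReal.ofReal (ξ ω) ∂μ = ∫⁻ ω, g ω ∂μ

theorem IsCondDensity.lintegral_ofReal_mul {ξ : Ω → ℝ} (h : IsCondDensity m μ ξ)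
    {v : Ω → ℝ} (hv : AEStronglyMeasurable[m] v μ) :
    ∫⁻ ω, ENNReal.ofReal (v ω) * ENNReal.ofReal (ξ ω) ∂μ = ∫⁻ ω, ENNReal.ofReal (v ω) ∂μ := by
  obtain ⟨v', hv', hvv⟩ := hv
  have := h (fun ω => ENNReal.ofReal (v' ω)) hv'.measurable.ennreal_ofReal
  rw [lintegral_congr_ae (g := fun ω => ENNReal.ofReal (v' ω) * ENNReal.ofReal (ξ ω)), this]
  · refine lintegral_congr_ae ?_
    filter_upwards [hvv] with ω hω
    rw [hω]
  · filter_upwards [hvv] with ω hω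
    rw [hω]

/-- The negative part satisfies `E[w⁻] = E[w⁻ ξ] = 0`, since `w⁻ ξ` is the negative part of `w ξ`.
-/
theorem IsCondDensity.nonneg_of_mul_nonneg {ξ : Ω → ℝ} (hm : m ≤ m0) (h : IsCondDensity m μ ξ)
    (hξ0 : 0 ≤ᵐ[μ] ξ) {w : Ω → ℝ} (hw : AEStronglyMeasurable[m] w μ)
    (hwξ : ∀ᵐ ω ∂μ, 0 ≤ w ω * ξ ω) : 0 ≤ᵐ[μ] w := by
  have h1 := h.lintegral_ofReal_mul hw.neg
  rw [lintegral_congr_ae (g := fun _ => 0), lintegral_zero] at h1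
  · have h2 := (lintegral_eq_zero_iff' ((hw.mono hm).aemeasurable.neg.ennreal_ofReal)).1 h1.symm
    filter_upwards [h2] with ω hω
    simpa using hω
  · filter_upwards [hwξ, hξ0] with ω h1 h2
    rw [mul_comm, ← ENNReal.ofReal_mul h2]
    simp only [Pi.neg_apply, ENNReal.ofReal_eq_zero]
    linarith

theorem IsCondDensity.integral_mul {ξ : Ω → ℝ} (h : IsCondDensity m μ ξ)
    (hξ0 : 0 ≤ᵐ[μ] ξ) {v : Ω → ℝ} (hv : AEStronglyMeasurable[m] v μ) (hvi : Integrable v μ)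
    (hvξ : Integrable (fun ω => v ω * ξ ω) μ) :
    ∫ ω, v ω * ξ ω ∂μ = ∫ ω, v ω ∂μ := by
  rw [integral_eq_lintegral_pos_part_sub_lintegral_neg_part hvξ,
    integral_eq_lintegral_pos_part_sub_lintegral_neg_part hvi]
  have h1 := h.lintegral_ofReal_mul hv
  have h2 := h.lintegral_ofReal_mul hv.neg
  simp only [Pi.neg_apply] at h2
  rw [← h1, ← h2]
  congr 2 <;>
  · refine lintegral_congr_ae ?_
    filter_upwards [hξ0] with ω hω
    simp only [← ENNReal.ofReal_mul' hω, neg_mul]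

variable [IsProbabilityMeasure μ]

/-- `E[w E[f | m]] = E[w f]` for nonnegative `m`-measurable weights `w`, with the conditional
expectation in the extended sense. -/
theorem integrable_mul_extCondExp (hm : m ≤ m0) {w f : Ω → ℝ} (hw : AEStronglyMeasurable[m] w μ)
    (hw0 : 0 ≤ᵐ[μ] w) (hf : AEMeasurable f μ) (hwf : Integrable (fun ω => w ω * f ω) μ) :
    Integrable (fun ω => w ω * extCondExp μ m f ω) μ ∧
      ∫ ω, w ω * extCondExp μ m f ω ∂μ = ∫ ω, w ω * f ω ∂μ := by
  -- Since `w ≥ 0`, the positive part of `w k` is `w k⁺`; the claim for `f` then follows from `k =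
  -- f` and `k = -f`. Where `E[k⁺ | m]` is infinite, finiteness of the integral forces `w = 0`
  -- almost surely, so the value `0` given by `toReal` is immaterial.
  have key : ∀ k : Ω → ℝ, AEMeasurable k μ → Integrable (fun ω => w ω * k ω) μ →
      Integrable (fun ω => w ω * (condLExp m μ (fun x => ENNReal.ofReal (k x)) ω).toReal) μ ∧
      ∫ ω, w ω * (condLExp m μ (fun x => ENNReal.ofReal (k x)) ω).toReal ∂μ
        = (∫⁻ ω, ENNReal.ofReal (w ω * k ω) ∂μ).toReal := by
    intro k hk hwk
    obtain ⟨w', hw', hww⟩ := hw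
    have h1 := lintegral_mul_condLExp hm hk.ennreal_ofReal hw'.measurable.ennreal_ofReal
    have h2 : ∫⁻ ω, ENNReal.ofReal (w' ω) * ENNReal.ofReal (k ω) ∂μ
        = ∫⁻ ω, ENNReal.ofReal (w ω * k ω) ∂μ := by
      refine lintegral_congr_ae ?_
      filter_upwards [hww, hw0] with ω h3 h4
      rw [← h3, ENNReal.ofReal_mul h4]
    rw [h2] at h1
    have hfin : ∫⁻ ω, ENNReal.ofReal (w ω * k ω) ∂μ ≠ ∞ := hwk.lintegral_lt_top.ne
    have hmeas : AEMeasurable (fun ω => ENNReal.ofReal (w' ω) *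
        condLExp m μ (fun x => ENNReal.ofReal (k x)) ω) μ :=
      ((hw'.measurable.mono hm le_rfl).ennreal_ofReal.mul
        (measurable_condLExp' m μ _)).aemeasurable
    have heq : (fun ω => w ω * (condLExp m μ (fun x => ENNReal.ofReal (k x)) ω).toReal)
        =ᵐ[μ] fun ω => (ENNReal.ofReal (w' ω) *
          condLExp m μ (fun x => ENNReal.ofReal (k x)) ω).toReal := by
      filter_upwards [hww, hw0] with ω h3 h4
      rw [ENNReal.toReal_mul, ← h3, ENNReal.toReal_ofReal h4]
    refine ⟨(integrable_toReal_of_lintegral_ne_top hmeas (h1 ▸ hfin)).congr heq.symm, ?_⟩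
    rw [integral_congr_ae heq, integral_toReal hmeas (ae_lt_top' hmeas (h1 ▸ hfin)), h1]
  obtain ⟨i1, e1⟩ := key f hf hwf
  obtain ⟨i2, e2⟩ := key (fun ω => -f ω) hf.neg (by simpa using hwf.neg)
  unfold extCondExp
  simp_rw [mul_sub]
  refine ⟨i1.sub i2, ?_⟩
  rw [integral_sub i1 i2, e1, e2, integral_eq_lintegral_pos_part_sub_lintegral_neg_part hwf]
  simp only [mul_neg]

end Weights

/-! ### Dual variables and their weighted densities -/

section DualVariables

variable {Ω : Type*} [m0 : MeasurableSpace Ω] {d : ℕ} {p q : ℝ≥0∞} {μ : Measure Ω}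
  [ENNReal.HolderConjugate q p]

theorem aestronglyMeasurable_apply {m : MeasurableSpace Ω} {f : Ω → Vec d}
    (hf : AEStronglyMeasurable[m] f μ) (i : Fin d) : AEStronglyMeasurable[m] (fun ω => f ω i) μ :=
  (EuclideanSpace.proj i : Vec d →L[ℝ] ℝ).continuous.comp_aestronglyMeasurable hf

theorem integrable_apply_mul (Y : Lp (Vec d) q μ) (X : Lp (Vec d) p μ) (i : Fin d) :
    Integrable (fun ω => Y ω i * X ω i) μ :=
  MemLp.integrable_mul ((Lp.memLp Y).eval_piLp i) ((Lp.memLp X).eval_piLp i)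

variable [IsProbabilityMeasure μ]

theorem isCondDensity_relDensity (F : Filtration ℕ m0) (ν : Measure Ω) {t T : ℕ} (ht : t ≤ T) :
    IsCondDensity (F t) μ (relDensity μ F t T ν) :=
  fun _ hg => lintegral_mul_relDensity F ν ht hg

theorem pairing_eq_sum (Y : Lp (Vec d) q μ) (X : Lp (Vec d) p μ) :
    pairing μ Y X = ∑ i, ∫ ω, Y ω i * X ω i ∂μ := by
  unfold pairing
  simp_rw [vec_inner]
  exact integral_finsetSum _ fun i _ => integrable_apply_mul Y X i

section Weighted

variable {F : Filtration ℕ m0} {t T : ℕ} {Q : Fin d → Measure Ω} {w Y : Lp (Vec d) q μ}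

/-- Componentwise nonnegativity of `w` is inherited from `diag(w) ξ^Q ≥ 0`; membership in the dual
cone of `(M_t)_+` alone would not give it. -/
theorem weight_nonneg (ht : t ≤ T) (hw : w ∈ LpSub μ F d q t) (hY : Y ∈ LpPos μ d q)
    (hYw : Y =ᵐ[μ] weightedDensity μ F t T Q w) (i : Fin d) : 0 ≤ᵐ[μ] fun ω => w ω i := by
  refine (isCondDensity_relDensity F (Q i) ht).nonneg_of_mul_nonneg (F.le t)
    (relDensity_nonneg F (Q i) t T)
    (aestronglyMeasurable_apply (mem_lpMeas_iff_aestronglyMeasurable.1 hw) i) ?_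
  filter_upwards [hY, hYw] with ω h1 h2
  have := h1 i
  rw [h2] at this
  exact this

/-- Each `w_i u_i` is `F_t`-measurable, so the factor `ξ^i` with `E[ξ^i | F_t] = 1` can be inserted.
-/
theorem pairing_weight (ht : t ≤ T) (hw : w ∈ LpSub μ F d q t)
    (hYw : Y =ᵐ[μ] weightedDensity μ F t T Q w) {u : Lp (Vec d) p μ} (hu : u ∈ LpSub μ F d p t) :
    pairing μ w u = pairing μ Y u := by
  rw [pairing_eq_sum, pairing_eq_sum]
  refine Finset.sum_congr rfl fun i _ => ?_
  have hY : (fun ω => Y ω i * u ω i)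
      =ᵐ[μ] fun ω => w ω i * u ω i * relDensity μ F t T (Q i) ω := by
    filter_upwards [hYw] with ω h
    rw [h]
    simp only [weightedDensity]
    ring
  rw [integral_congr_ae hY]
  exact ((isCondDensity_relDensity F (Q i) ht).integral_mul (relDensity_nonneg F (Q i) t T)
    ((aestronglyMeasurable_apply (mem_lpMeas_iff_aestronglyMeasurable.1 hw) i).mul
      (aestronglyMeasurable_apply (mem_lpMeas_iff_aestronglyMeasurable.1 hu) i))
    (integrable_apply_mul w u i) ((integrable_apply_mul Y u i).congr hY)).symm

/-- The nonnegative weights `w_i` move inside the extended conditional expectation, where they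
combine with `ξ^i` to give `Y_i`. -/
theorem pairing_condExpQ (ht : t ≤ T) (hw : w ∈ LpSub μ F d q t) (hY : Y ∈ LpPos μ d q)
    (hYw : Y =ᵐ[μ] weightedDensity μ F t T Q w) (X : Lp (Vec d) p μ) :
    pairing μ w (condExpQ μ F t T Q X) = pairing μ Y X := by
  have key : ∀ i, Integrable (fun ω => w ω i * extCondExp μ (F t)
        (fun x => relDensity μ F t T (Q i) x * X x i) ω) μ ∧
      ∫ ω, w ω i * extCondExp μ (F t) (fun x => relDensity μ F t T (Q i) x * X x i) ω ∂μ
        = ∫ ω, Y ω i * X ω i ∂μ := by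
    intro i
    have hYi : (fun ω => Y ω i * X ω i)
        =ᵐ[μ] fun ω => w ω i * (relDensity μ F t T (Q i) ω * X ω i) := by
      filter_upwards [hYw] with ω h
      rw [h]
      simp only [weightedDensity]
      ring
    rw [integral_congr_ae hYi]
    exact integrable_mul_extCondExp (F.le t)
      (aestronglyMeasurable_apply (mem_lpMeas_iff_aestronglyMeasurable.1 hw) i)
      (weight_nonneg ht hw hY hYw i)
      (((measurable_relDensity F (Q i) t T).mono (F.le T) le_rfl).aemeasurable.mul
        (aestronglyMeasurable_apply (Lp.aestronglyMeasurable X) i).aemeasurable)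
      ((integrable_apply_mul Y X i).congr hYi)
  rw [pairing_eq_sum]
  simp_rw [← (key _).2]
  rw [← integral_finsetSum _ fun i _ => (key i).1]
  unfold pairing
  simp_rw [vec_inner]
  rfl

theorem mem_shiftedHalfspace_neg (ht : t ≤ T) (hw : w ∈ LpSub μ F d q t) (hY : Y ∈ LpPos μ d q)
    (hYw : Y =ᵐ[μ] weightedDensity μ F t T Q w) {M : Submodule ℝ (Lp (Vec d) p μ)}
    (hM : M ≤ LpSub μ F d p t) (X u : Lp (Vec d) p μ) :
    u ∈ shiftedHalfspace F t T M Q w (-X) ↔ u ∈ M ∧ 0 ≤ pairing μ Y X + pairing μ Y u := by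
  refine and_congr_right fun hu => ?_
  have := Fact.mk (ENNReal.HolderConjugate.one_le p q)
  have := Fact.mk (ENNReal.HolderConjugate.one_le q p)
  rw [pairing_condExpQ ht hw hY hYw, pairing_weight ht hw hYw (hM hu), ← pairingL_apply Y (-X),
    map_neg, pairingL_apply, neg_le_iff_add_nonneg']

end Weighted

/-- A probability measure with a prescribed relative density. -/
theorem exists_relDensity_eq {F : Filtration ℕ m0} {t T : ℕ} (ht : t ≤ T) (hFT : F T = m0)
    {Z : Ω → ℝ} (hZ : Measurable Z) (hZ0 : 0 ≤ᵐ[μ] Z) (hZt : IsCondDensity (F t) μ Z) :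
    ∃ ν : Measure Ω, IsProbabilityMeasure ν ∧ ν ≪ μ ∧ relDensity μ F t T ν =ᵐ[μ] Z := by
  have h1 : ∫⁻ ω, ENNReal.ofReal (Z ω) ∂μ = 1 := by
    simpa using hZt (fun _ => 1) measurable_const
  have hZi : Integrable Z μ := by
    refine ⟨hZ.aestronglyMeasurable, ?_⟩
    rw [hasFiniteIntegral_iff_ofReal hZ0, h1]
    exact ENNReal.one_lt_top
  -- The density process of this measure is `1` at time `t` and `Z` at time `T`, so the relative
  -- density between the two times is `Z`.
  let ν := μ.withDensity fun ω => ENNReal.ofReal (Z ω)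
  have hν : (fun ω => (ν.rnDeriv μ ω).toReal) =ᵐ[μ] Z := by
    filter_upwards [Measure.rnDeriv_withDensity μ hZ.ennreal_ofReal, hZ0] with ω h2 h3
    rw [h2, ENNReal.toReal_ofReal h3]
  have hDT : densityProcess μ F ν T =ᵐ[μ] Z := by
    refine (condExp_congr_ae hν).trans ?_
    rw [condExp_of_stronglyMeasurable (F.le T) (by rw [hFT]; exact hZ.stronglyMeasurable) hZi]
  have hDt : densityProcess μ F ν t =ᵐ[μ] fun _ => 1 := by
    refine (condExp_congr_ae hν).trans ?_
    refine (ae_eq_condExp_of_forall_setIntegral_eq (F.le t) hZi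
      (fun s _ _ => (integrable_const _).integrableOn) (fun s hs _ => ?_)
      aestronglyMeasurable_const).symm
    have hs' := F.le t s hs
    have h2 := hZt (s.indicator fun _ => 1) (measurable_const.indicator hs)
    rw [lintegral_indicator hs'] at h2
    have h3 : ∫⁻ ω, s.indicator (fun _ => 1) ω * ENNReal.ofReal (Z ω) ∂μ
        = ∫⁻ ω in s, ENNReal.ofReal (Z ω) ∂μ := by
      rw [← lintegral_indicator hs']
      exact lintegral_congr fun ω => by by_cases hω : ω ∈ s <;> simp [hω]
    rw [integral_eq_lintegral_of_nonneg_ae (ae_restrict_of_ae hZ0) hZ.aestronglyMeasurable,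
      ← h3, h2]
    simp [measureReal_def]
  refine ⟨ν, ⟨?_⟩, withDensity_absolutelyContinuous _ _, ?_⟩
  · rw [withDensity_apply _ MeasurableSet.univ, setLIntegral_univ, h1]
  · filter_upwards [densityProcess_mul_relDensity F ν ht, hDT, hDt] with ω h2 h3 h4
    rw [h4, one_mul] at h2
    rw [h2, h3]

/-- Every nonnegative `Y ∈ L^q_d` that does not vanish on `M` is the weighted density of a pair of
dual variables. -/
theorem exists_dualVars [Fact (1 ≤ q)] {F : Filtration ℕ m0} {t T : ℕ} (ht : t ≤ T) (hFT : F T = m0)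
    {M : Submodule ℝ (Lp (Vec d) p μ)} (hM : M ≤ LpSub μ F d p t) {Y : Lp (Vec d) q μ}
    (hY : Y ∈ LpPos μ d q) (hYM : ∃ u ∈ M, pairing μ Y u ≠ 0) :
    ∃ z ∈ dualVars F q t T M, Y =ᵐ[μ] weightedDensity μ F t T z.1 z.2 := by
  -- Factor `Y_i = E[Y_i | F_t] · (Y_i / E[Y_i | F_t])`: the first factor becomes the weight, the
  -- second the relative density of `Q_i`.
  let w₀ : Fin d → Ω → ℝ := fun i => μ[fun ω => Y ω i | F t]
  have hYi : ∀ i, MemLp (fun ω => Y ω i) q μ := fun i => (Lp.memLp Y).eval_piLp i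
  have hYint : ∀ i, Integrable (fun ω => Y ω i) μ := fun i => (hYi i).integrable Fact.out
  have hY0 : ∀ i, 0 ≤ᵐ[μ] fun ω => Y ω i := fun i => by
    filter_upwards [hY] with ω hω using hω i
  have hYm : ∀ i, Measurable fun ω => Y ω i := fun i =>
    ((EuclideanSpace.proj i : Vec d →L[ℝ] ℝ).continuous.comp_stronglyMeasurable
      (Lp.stronglyMeasurable Y)).measurable
  have hw₀ : ∀ i, Measurable[F t] (w₀ i) := fun i => stronglyMeasurable_condExp.measurable
  have hwL : MemLp (fun ω => (WithLp.toLp 2 fun i => w₀ i ω : Vec d)) q μ :=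
    memLp_piLp_iff.2 fun i => (hYi i).condExp Fact.out
  let w : Lp (Vec d) q μ := hwL.toLp _
  have hww : ∀ᵐ ω ∂μ, ∀ i, w ω i = w₀ i ω := by
    filter_upwards [hwL.coeFn_toLp] with ω hω i
    rw [hω]
  have hwm : w ∈ LpSub μ F d q t := by
    rw [mem_lpMeas_iff_aestronglyMeasurable]
    refine ⟨_, ?_, hwL.coeFn_toLp⟩
    have h1 : Measurable[F t] fun ω i => w₀ i ω := @measurable_pi_lambda _ _ _ (F t) _ _ hw₀
    exact ((PiLp.continuous_toLp 2 _).measurable.comp h1).stronglyMeasurable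
  let Z : Fin d → Ω → ℝ := fun i => quotDensity (fun ω => Y ω i) (w₀ i)
  choose Q hQp hQa hQ using fun i => exists_relDensity_eq (μ := μ) ht hFT
    (measurable_quotDensity (hYm i) ((hw₀ i).mono (F.le t) le_rfl))
    (quotDensity_nonneg (D := w₀ i) (hY0 i))
    (fun _ hg => lintegral_mul_quotDensity (F.le t) (hYint i) (hY0 i) EventuallyEq.rfl (hw₀ i) hg)
  have hYw : Y =ᵐ[μ] weightedDensity μ F t T Q w := by
    have h1 : ∀ᵐ ω ∂μ, ∀ i, w₀ i ω * quotDensity (fun ω => Y ω i) (w₀ i) ω = Y ω i :=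
      ae_all_iff.2 fun i =>
        mul_quotDensity (F.le t) (hYint i) (hY0 i) EventuallyEq.rfl (hw₀ i)
    filter_upwards [h1, hww, ae_all_iff.2 hQ] with ω h2 h3 h4
    ext i
    simp only [weightedDensity]
    rw [h3, h4, h2]
  have hpair : ∀ u ∈ M, pairing μ w u = pairing μ Y u := fun u hu =>
    pairing_weight ht hwm hYw (hM hu)
  refine ⟨(Q, w), ⟨fun i => ⟨hQp i, hQa i⟩, ⟨⟨hwm, fun u hu => ?_⟩, fun h => ?_⟩, Y, hY, hYw⟩, hYw⟩
  · rw [hpair u hu.1, pairing_eq_sum]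
    refine Finset.sum_nonneg fun i _ => integral_nonneg_of_ae ?_
    filter_upwards [hY, hu.2] with ω h1 h2 using mul_nonneg (h1 i) (h2 i)
  · obtain ⟨u, hu, hne⟩ := hYM
    exact hne ((hpair u hu).symm.trans (h.2 u hu))

end DualVariables

/-! ### Sign and linearity of the pairing. -/

section Main

variable {Ω : Type*} [m0 : MeasurableSpace Ω] {d : ℕ} {p q : ℝ≥0∞} {μ : Measure Ω}
  [IsProbabilityMeasure μ]

theorem pairing_nonneg {Y : Lp (Vec d) q μ} {X : Lp (Vec d) p μ} (hY : Y ∈ LpPos μ d q)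
    (hX : X ∈ LpPos μ d p) : 0 ≤ pairing μ Y X := by
  refine integral_nonneg_of_ae ?_
  filter_upwards [hY, hX] with ω h1 h2
  rw [vec_inner]
  exact Finset.sum_nonneg fun i _ => mul_nonneg (h1 i) (h2 i)

theorem zero_mem_LpPos : (0 : Lp (Vec d) p μ) ∈ LpPos μ d p := by
  filter_upwards [Lp.coeFn_zero (Vec d) p μ] with ω h i
  rw [h]
  exact le_rfl

/-- Testing with `1_s e_i` gives nonnegative integrals of `Y_i` over every measurable set `s`. -/
theorem mem_LpPos_of_pairing_nonneg [ENNReal.HolderConjugate q p] {Y : Lp (Vec d) q μ}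
    (h : ∀ X ∈ LpPos μ d p, 0 ≤ pairing μ Y X) : Y ∈ LpPos μ d q := by
  have : Fact (1 ≤ q) := ⟨ENNReal.HolderConjugate.one_le q p⟩
  refine ae_all_iff.2 fun i => ?_
  have hYi : Integrable (fun ω => Y ω i) μ := ((Lp.memLp Y).eval_piLp i).integrable Fact.out
  refine ae_nonneg_of_forall_setIntegral_nonneg hYi fun s hs _ => ?_
  have h1 := indicatorConstLp_coeFn (p := p) (hs := hs) (hμs := measure_ne_top μ s)
    (c := (EuclideanSpace.single i (1 : ℝ) : Vec d))
  have h2 := h (indicatorConstLp p hs (measure_ne_top μ s) (EuclideanSpace.single i (1 : ℝ))) ?_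
  · refine h2.trans_eq ?_
    rw [← integral_indicator hs]
    refine integral_congr_ae ?_
    filter_upwards [h1] with ω hω
    rw [hω]
    by_cases hs : ω ∈ s <;> simp [hs, EuclideanSpace.inner_single_right]
  · filter_upwards [h1] with ω hω j
    rw [hω]
    by_cases hs : ω ∈ s
    · simp only [hs, Set.indicator_of_mem, PiLp.single_apply]
      split_ifs
      exacts [zero_le_one, le_rfl]
    · simp [hs]

variable [Fact (1 ≤ p)] [Fact (1 ≤ q)] [ENNReal.HolderConjugate q p]

theorem pairing_add (Y : Lp (Vec d) q μ) (X X' : Lp (Vec d) p μ) :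
    pairing μ Y ↑(X + X') = pairing μ Y X + pairing μ Y X' := by
  simp_rw [← pairingL_apply, map_add]

theorem pairing_smul (Y : Lp (Vec d) q μ) (c : ℝ) (X : Lp (Vec d) p μ) :
    pairing μ Y ↑(c • X) = c * pairing μ Y X := by
  simp_rw [← pairingL_apply, map_smul, smul_eq_mul]

theorem pairing_neg (Y : Lp (Vec d) q μ) (X : Lp (Vec d) p μ) :
    pairing μ Y ↑(-X) = -pairing μ Y X := by
  simp_rw [← pairingL_apply, map_neg]

theorem pairing_zero (Y : Lp (Vec d) q μ) : pairing μ Y ↑(0 : Lp (Vec d) p μ) = 0 := by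
  simp_rw [← pairingL_apply, map_zero]

theorem pairing_add_smul_left (Y Y' : Lp (Vec d) q μ) (c : ℝ) (X : Lp (Vec d) p μ) :
    pairing μ ↑(Y + c • Y') X = pairing μ Y X + c * pairing μ Y' X := by
  simp_rw [← pairingL_apply]
  simp

/-! ### Risk measures defined by a set of positive functionals -/

/-- The set-valued function `X ↦ {u ∈ M : E[Yᵀ(X + u)] ≥ 0 for all Y ∈ S}`. -/
def polarRM (M : Submodule ℝ (Lp (Vec d) p μ)) (S : Set (Lp (Vec d) q μ))
    (X : Lp (Vec d) p μ) : Set (Lp (Vec d) p μ) :=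
  {u | u ∈ M ∧ ∀ Y ∈ S, 0 ≤ pairing μ Y X + pairing μ Y u}

theorem isClosedRM_polarRM {M : Submodule ℝ (Lp (Vec d) p μ)}
    (hM : IsClosed[LpTop μ d p] (M : Set (Lp (Vec d) p μ))) (S : Set (Lp (Vec d) q μ)) :
    IsClosedRM (polarRM M S) := by
  let _ := LpTop μ d p
  have hset : {z : Lp (Vec d) p μ × Lp (Vec d) p μ | z.2 ∈ polarRM M S z.1}
      = (Prod.snd ⁻¹' (M : Set (Lp (Vec d) p μ))) ∩
        ⋂ Y ∈ S, {z : Lp (Vec d) p μ × Lp (Vec d) p μ | 0 ≤ pairing μ Y z.1 + pairing μ Y z.2} := by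
    ext z
    simp [polarRM]
  unfold IsClosedRM
  rw [hset]
  refine (hM.preimage continuous_snd).inter (isClosed_biInter fun Y _ => ?_)
  exact isClosed_le continuous_const
    (((continuous_pairing Y).comp continuous_fst).add ((continuous_pairing Y).comp continuous_snd))

/-- Linearity of the functionals gives translativity, subadditivity and homogeneity; their
positivity gives monotonicity and upper sets; the one that is nonzero on `M` keeps the value at `0`
from being all of `M`. -/
theorem isClosedCoherent_polarRM {M : Submodule ℝ (Lp (Vec d) p μ)}
    (hM : IsClosed[LpTop μ d p] (M : Set (Lp (Vec d) p μ))) {S : Set (Lp (Vec d) q μ)}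
    (hpos : ∀ Y ∈ S, Y ∈ LpPos μ d q) (hS : ∃ Y ∈ S, ∃ u ∈ M, pairing μ Y u ≠ 0) :
    IsClosedCoherentCondRiskMeasure M (polarRM M S) := by
  refine ⟨⟨fun X => ⟨fun u hu => hu.1, ?_⟩, fun X m hm => ?_, fun X X' hX u hu => ?_, ?_, ?_⟩,
    isClosedRM_polarRM hM S, Or.inr ⟨fun X X' => ?_, fun X l hl => ?_⟩⟩
  · refine Set.Subset.antisymm (fun u hu => ?_) ?_
    · exact ⟨u, hu, 0, ⟨M.zero_mem, zero_mem_LpPos⟩, add_zero u⟩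
    · rintro _ ⟨u, hu, v, hv, rfl⟩
      refine ⟨M.add_mem hu.1 hv.1, fun Y hY => ?_⟩
      rw [pairing_add]
      have := hu.2 Y hY
      have := pairing_nonneg (hpos Y hY) hv.2
      linarith
  · ext u
    constructor
    · intro hu
      refine ⟨u + m, ⟨M.add_mem hu.1 hm, fun Y hY => ?_⟩, add_sub_cancel_right u m⟩
      have := hu.2 Y hY
      rw [pairing_add] at this ⊢
      linarith
    · rintro ⟨v, hv, rfl⟩
      refine ⟨M.sub_mem hv.1 hm, fun Y hY => ?_⟩
      have := hv.2 Y hY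
      change 0 ≤ pairing μ Y ↑(X + m) + pairing μ Y ↑(v - m)
      rw [sub_eq_add_neg, pairing_add, pairing_add, pairing_neg]
      linarith
  · refine ⟨hu.1, fun Y hY => ?_⟩
    have h1 := hu.2 Y hY
    have h2 := pairing_nonneg (hpos Y hY) hX
    rw [sub_eq_add_neg, pairing_add, pairing_neg] at h2
    linarith
  · exact ⟨0, M.zero_mem, fun Y _ => by rw [pairing_zero, add_zero]⟩
  · intro h
    obtain ⟨Y, hY, u, hu, hne⟩ := hS
    -- A linear functional that is nonnegative on a subspace vanishes on it.
    have key : ∀ v ∈ M, 0 ≤ pairing μ Y v := fun v hv => by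
      have hv' : v ∈ polarRM M S 0 := by
        rw [h]
        exact hv
      simpa only [pairing_zero, zero_add] using hv'.2 Y hY
    have h1 := key u hu
    have h2 := key (-u) (M.neg_mem hu)
    rw [pairing_neg] at h2
    exact hne (by linarith)
  · rintro _ ⟨u, hu, v, hv, rfl⟩
    refine ⟨M.add_mem hu.1 hv.1, fun Y hY => ?_⟩
    have h1 := hu.2 Y hY
    have h2 := hv.2 Y hY
    change 0 ≤ pairing μ Y ↑(X + X') + pairing μ Y ↑(u + v)
    rw [pairing_add, pairing_add]
    linarith
  · ext u
    rw [Set.mem_smul_set_iff_inv_smul_mem₀ hl.ne']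
    refine and_congr (M.smul_mem_iff (inv_ne_zero hl.ne')).symm
      (forall₂_congr fun Y _ => ?_)
    rw [pairing_smul, pairing_smul, ← mul_nonneg_iff_of_pos_left (inv_pos.2 hl), mul_add,
      inv_mul_cancel_left₀ hl.ne']

/-! ### The acceptance set -/

section Acceptance

variable {M : Submodule ℝ (Lp (Vec d) p μ)} {R : Lp (Vec d) p μ → Set (Lp (Vec d) p μ)}

theorem mem_iff_add_mem_acceptanceSet (hR : IsCondRiskMeasure M R) (X u : Lp (Vec d) p μ) :
    u ∈ R X ↔ u ∈ M ∧ X + u ∈ acceptanceSet R := by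
  constructor
  · intro hu
    have hM := (hR.mem_upperSets X).1 hu
    refine ⟨hM, ?_⟩
    change (0 : Lp (Vec d) p μ) ∈ R (X + u)
    rw [hR.translative X u hM]
    exact ⟨u, hu, sub_self u⟩
  · rintro ⟨hM, h⟩
    change (0 : Lp (Vec d) p μ) ∈ R (X + u) at h
    rw [hR.translative X u hM] at h
    obtain ⟨v, hv, hvu⟩ := h
    rwa [← sub_eq_zero.1 hvu]

theorem isClosed_acceptanceSet (hR : IsClosedRM R) : IsClosed[LpTop μ d p] (acceptanceSet R) := by
  let _ := LpTop μ d p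
  exact IsClosed.preimage (f := fun X : Lp (Vec d) p μ => (X, (0 : Lp (Vec d) p μ)))
    (continuous_id.prodMk continuous_const) hR

theorem smul_mem_acceptanceSet (hR : IsPosHomRM R) {l : ℝ} (hl : 0 < l) {X : Lp (Vec d) p μ}
    (hX : X ∈ acceptanceSet R) : l • X ∈ acceptanceSet R := by
  change (0 : Lp (Vec d) p μ) ∈ R (l • X)
  rw [hR X l hl]
  exact ⟨0, hX, smul_zero l⟩

theorem add_mem_acceptanceSet (hR : IsCoherentRM R) {X X' : Lp (Vec d) p μ}
    (hX : X ∈ acceptanceSet R) (hX' : X' ∈ acceptanceSet R) : X + X' ∈ acceptanceSet R := by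
  rcases hR with ⟨hc, hh⟩ | ⟨hs, -⟩
  · have h2 := hc ((2 : ℝ) • X) ((2 : ℝ) • X') (1 / 2) (by norm_num) (by norm_num)
    rw [smul_smul, smul_smul] at h2
    norm_num at h2
    exact h2 ⟨0, ⟨0, smul_mem_acceptanceSet hh two_pos hX, smul_zero _⟩,
      0, ⟨0, smul_mem_acceptanceSet hh two_pos hX', smul_zero _⟩, add_zero 0⟩
  · exact hs X X' ⟨0, hX, 0, hX', add_zero 0⟩

theorem IsCoherentRM.isPosHomRM (hR : IsCoherentRM R) : IsPosHomRM R := by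
  rcases hR with h | h
  exacts [h.2, h.2]

/-- Homogeneity covers only positive factors, so `0` is reached as the limit of `c • u`, `c ↓ 0`,
for some `u ∈ R 0`, using closedness. -/
theorem zero_mem_acceptanceSet (hR : IsClosedCoherentCondRiskMeasure M R) :
    (0 : Lp (Vec d) p μ) ∈ acceptanceSet R := by
  obtain ⟨hrm, hcl, hco⟩ := hR
  obtain ⟨u, hu⟩ := hrm.nonempty_zero
  have huA : u ∈ acceptanceSet R := by
    simpa using ((mem_iff_add_mem_acceptanceSet hrm 0 u).1 hu).2
  obtain ⟨-, h2, -⟩ := LpTop_locallyConvex (μ := μ) (d := d) (p := p)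
  let _ := LpTop μ d p
  have hlim : Tendsto (fun c : ℝ => c • u) (𝓝[>] 0) (𝓝 0) := by
    have : Tendsto (fun c : ℝ => c • u) (𝓝 0) (𝓝 ((0 : ℝ) • u)) :=
      (continuous_id.smul continuous_const).tendsto 0
    rw [zero_smul] at this
    exact this.mono_left nhdsWithin_le_nhds
  refine (isClosed_acceptanceSet hcl).mem_of_tendsto hlim ?_
  filter_upwards [self_mem_nhdsWithin] with c hc
  exact smul_mem_acceptanceSet hco.isPosHomRM hc huA

theorem LpPos_subset_acceptanceSet (hR : IsClosedCoherentCondRiskMeasure M R) :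
    LpPos μ d p ⊆ acceptanceSet R := fun X hX =>
  hR.1.monotone 0 X (by simpa using hX) (zero_mem_acceptanceSet hR)

theorem posDual_subset_LpPos (hR : IsClosedCoherentCondRiskMeasure M R) :
    posDual q (acceptanceSet R) ⊆ LpPos μ d q := fun _ hY =>
  mem_LpPos_of_pairing_nonneg fun X hX => hY X (LpPos_subset_acceptanceSet hR hX)

/-- Separation of a point from the acceptance set. -/
theorem exists_mem_posDual_pairing_neg (hR : IsClosedCoherentCondRiskMeasure M R)
    {X : Lp (Vec d) p μ} (hX : X ∉ acceptanceSet R) :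
    ∃ Y ∈ posDual q (acceptanceSet R), pairing μ Y X < 0 := by
  obtain ⟨h1, h2, h3⟩ := LpTop_locallyConvex (μ := μ) (d := d) (p := p)
  have hcl := isClosed_acceptanceSet hR.2.1
  let _ := LpTop μ d p
  let C : ProperCone ℝ (Lp (Vec d) p μ) :=
    { carrier := acceptanceSet R
      add_mem' := fun hx hy => add_mem_acceptanceSet hR.2.2 hx hy
      zero_mem' := zero_mem_acceptanceSet hR
      smul_mem' := fun c x hx => by
        rcases c.2.eq_or_lt with h0 | h0
        · have : c = 0 := Subtype.ext h0.symm
          rw [this, zero_smul]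
          exact zero_mem_acceptanceSet hR
        · exact smul_mem_acceptanceSet hR.2.2.isPosHomRM h0 hx
      isClosed' := hcl }
  obtain ⟨f, hf, hfX⟩ := C.hyperplane_separation_point (x₀ := X) hX
  -- The separating functional is nonnegative on the cone, hence on `L^p_+`, so the representation
  -- of positive functionals suffices.
  obtain ⟨Y, hY⟩ := exists_pairing_of_positive (q := q) f.toLinearMap f.continuous
    fun X hX => hf X (LpPos_subset_acceptanceSet hR hX)
  refine ⟨Y, fun X hX => ?_, ?_⟩
  · rw [← hY]
    exact hf X hX
  · rw [← hY]
    exact hfX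

/-- Since `R 0 ≠ M`, some `u ∈ M` is not acceptable; a functional separating it is negative at `u`.
-/
theorem exists_mem_posDual_pairing_ne_zero (hR : IsClosedCoherentCondRiskMeasure M R) :
    ∃ Y ∈ posDual q (acceptanceSet R), ∃ u ∈ M, pairing μ Y u ≠ 0 := by
  have h : ∃ u ∈ M, u ∉ R 0 := by
    by_contra! h
    exact hR.1.zero_ne (Set.Subset.antisymm (hR.1.mem_upperSets 0).1 h)
  obtain ⟨u, hu, hu0⟩ := h
  have huA : u ∉ acceptanceSet R := fun h =>
    hu0 ((mem_iff_add_mem_acceptanceSet hR.1 0 u).2 ⟨hu, by simpa using h⟩)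
  obtain ⟨Y, hY, hneg⟩ := exists_mem_posDual_pairing_neg (q := q) hR huA
  exact ⟨Y, hY, u, hu, hneg.ne⟩

/-- The bipolar representation of a closed coherent risk measure; the functionals that vanish on
`M` are not needed. -/
theorem eq_polarRM (hR : IsClosedCoherentCondRiskMeasure M R) :
    R = polarRM M {Y | Y ∈ posDual q (acceptanceSet R) ∧ ∃ u ∈ M, pairing μ Y u ≠ 0} := by
  funext X
  ext u
  rw [mem_iff_add_mem_acceptanceSet hR.1]
  refine and_congr_right fun hu => ⟨fun h Y hY => ?_, fun h => ?_⟩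
  · rw [← pairing_add]
    exact hY.1 _ h
  · by_contra hXu
    obtain ⟨Y₀, hY₀, hneg⟩ := exists_mem_posDual_pairing_neg (q := q) hR hXu
    by_cases hY₀M : ∃ u ∈ M, pairing μ Y₀ u ≠ 0
    · have := h Y₀ ⟨hY₀, hY₀M⟩
      rw [← pairing_add] at this
      exact this.not_gt hneg
    · push Not at hY₀M
      obtain ⟨Y₁, hY₁, v, hv, hne⟩ := exists_mem_posDual_pairing_ne_zero (q := q) hR
      -- When the separating `Y₀` vanishes on `M`, the perturbation `Y₀ + ε Y₁` stays in the dual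
      -- cone and is nonzero on `M`; letting `ε ↓ 0` contradicts the strict separation.
      have hlim : Tendsto (fun ε : ℝ => pairing μ Y₀ ↑(X + u) + ε * pairing μ Y₁ ↑(X + u))
          (𝓝[>] 0) (𝓝 (pairing μ Y₀ ↑(X + u))) := by
        have : Tendsto (fun ε : ℝ => pairing μ Y₀ ↑(X + u) + ε * pairing μ Y₁ ↑(X + u))
            (𝓝 0) (𝓝 (pairing μ Y₀ ↑(X + u) + 0 * pairing μ Y₁ ↑(X + u))) :=
          tendsto_const_nhds.add (tendsto_id.mul tendsto_const_nhds)
        rw [zero_mul, add_zero] at this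
        exact this.mono_left nhdsWithin_le_nhds
      refine (ge_of_tendsto hlim ?_).not_gt hneg
      filter_upwards [self_mem_nhdsWithin] with ε hε
      have hε' : 0 < ε := hε
      have := h (Y₀ + ε • Y₁) ⟨fun Z hZ => ?_, v, hv, ?_⟩
      · rwa [← pairing_add, pairing_add_smul_left] at this
      · rw [pairing_add_smul_left]
        have := hY₀ Z hZ
        have := mul_nonneg hε'.le (hY₁ Z hZ)
        linarith
      · rw [pairing_add_smul_left, hY₀M v hv, zero_add]
        exact mul_ne_zero hε'.ne' hne

end Acceptance

/-! ### Dual representations -/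

section Representation

variable {F : Filtration ℕ m0} {t T : ℕ} {M : Submodule ℝ (Lp (Vec d) p μ)}
  {R : Lp (Vec d) p μ → Set (Lp (Vec d) p μ)}

/-- The set of the weighted densities of the pairs in `W`. -/
def weightedDensities (F : Filtration ℕ m0) (t T : ℕ)
    (W : Set ((Fin d → Measure Ω) × Lp (Vec d) q μ)) : Set (Lp (Vec d) q μ) :=
  {Y | ∃ z ∈ W, Y =ᵐ[μ] weightedDensity μ F t T z.1 z.2}

theorem mem_LpPos_of_dualVars {W : Set ((Fin d → Measure Ω) × Lp (Vec d) q μ)}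
    (hW : W ⊆ dualVars F q t T M) {Y : Lp (Vec d) q μ} (hY : Y ∈ weightedDensities F t T W) :
    Y ∈ LpPos μ d q := by
  obtain ⟨z, hz, hYz⟩ := hY
  obtain ⟨Y', hY', hYz'⟩ := (hW hz).2.2
  rwa [Lp.ext (hYz.trans hYz'.symm)]

/-- Nonemptiness of `W` matters: an empty intersection is the whole space, while the right-hand side
would be `M`. -/
theorem biInter_shiftedHalfspace (ht : t ≤ T) (hM : M ≤ LpSub μ F d p t)
    {W : Set ((Fin d → Measure Ω) × Lp (Vec d) q μ)} (hW : W ⊆ dualVars F q t T M)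
    (hWne : W.Nonempty) (X : Lp (Vec d) p μ) :
    ⋂ z ∈ W, shiftedHalfspace F t T M z.1 z.2 (-X) = polarRM M (weightedDensities F t T W) X := by
  ext u
  rw [Set.mem_iInter₂]
  constructor
  · intro h
    obtain ⟨z, hz⟩ := hWne
    refine ⟨(h z hz).1, fun Y hY => ?_⟩
    obtain ⟨z', hz', hYz⟩ := id hY
    exact ((mem_shiftedHalfspace_neg ht (hW hz').2.1.1.1 (mem_LpPos_of_dualVars hW hY) hYz hM
      X u).1 (h z' hz')).2
  · intro h z hz
    obtain ⟨Y, hY, hYz⟩ := (hW hz).2.2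
    exact (mem_shiftedHalfspace_neg ht (hW hz).2.1.1.1 hY hYz hM X u).2 ⟨h.1, h.2 Y ⟨z, hz, hYz⟩⟩

theorem isDualRepresentation_iff (ht : t ≤ T) (hM : M ≤ LpSub μ F d p t)
    {W : Set ((Fin d → Measure Ω) × Lp (Vec d) q μ)} (hW : W ⊆ dualVars F q t T M)
    (hWne : W.Nonempty) :
    IsDualRepresentation F t T M R W ↔ R = polarRM M (weightedDensities F t T W) := by
  unfold IsDualRepresentation
  simp_rw [biInter_shiftedHalfspace ht hM hW hWne]
  exact funext_iff.symm

theorem exists_pairing_ne_zero_of_dualVars (ht : t ≤ T) (hM : M ≤ LpSub μ F d p t)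
    {z : (Fin d → Measure Ω) × Lp (Vec d) q μ} (hz : z ∈ dualVars F q t T M)
    {Y : Lp (Vec d) q μ} (hY : Y =ᵐ[μ] weightedDensity μ F t T z.1 z.2) :
    ∃ u ∈ M, pairing μ Y u ≠ 0 := by
  by_contra! h
  exact hz.2.1.2 ⟨hz.2.1.1.1, fun u hu => (pairing_weight ht hz.2.1.1.1 hY (hM hu)).trans (h u hu)⟩

theorem isClosedCoherent_of_isDualRepresentation (ht : t ≤ T) (hM : M ≤ LpSub μ F d p t)
    (hMc : IsClosed[LpTop μ d p] (M : Set (Lp (Vec d) p μ)))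
    {W : Set ((Fin d → Measure Ω) × Lp (Vec d) q μ)} (hW : W ⊆ dualVars F q t T M)
    (hWne : W.Nonempty) (hR : IsDualRepresentation F t T M R W) :
    IsClosedCoherentCondRiskMeasure M R := by
  rw [(isDualRepresentation_iff ht hM hW hWne).1 hR]
  refine isClosedCoherent_polarRM hMc (fun Y hY => mem_LpPos_of_dualVars hW hY) ?_
  obtain ⟨z, hz⟩ := hWne
  obtain ⟨Y, -, hYz⟩ := (hW hz).2.2
  exact ⟨Y, ⟨z, hz, hYz⟩, exists_pairing_ne_zero_of_dualVars ht hM (hW hz) hYz⟩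

/-- Dual elements are automatically nonnegative, so those that do not vanish on `M` factor as
weighted densities; this identifies the maximal dual set with the index set of `eq_polarRM`. -/
theorem weightedDensities_maxDualVars (ht : t ≤ T) (hFT : F T = m0) (hM : M ≤ LpSub μ F d p t)
    (hR : IsClosedCoherentCondRiskMeasure M R) :
    weightedDensities F t T (maxDualVars F q t T M R) =
      {Y | Y ∈ posDual q (acceptanceSet R) ∧ ∃ u ∈ M, pairing μ Y u ≠ 0} := by
  ext Y
  constructor
  · rintro ⟨z, ⟨hz, Y', hY', hYz'⟩, hYz⟩
    rw [← Lp.ext (hYz.trans hYz'.symm)] at hY'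
    exact ⟨hY', exists_pairing_ne_zero_of_dualVars ht hM hz hYz⟩
  · rintro ⟨hY, hYM⟩
    obtain ⟨z, hz, hYz⟩ := exists_dualVars ht hFT hM (posDual_subset_LpPos hR hY) hYM
    exact ⟨z, ⟨hz, Y, hY, hYz⟩, hYz⟩

theorem maxDualVars_nonempty (ht : t ≤ T) (hFT : F T = m0) (hM : M ≤ LpSub μ F d p t)
    (hR : IsClosedCoherentCondRiskMeasure M R) : (maxDualVars F q t T M R).Nonempty := by
  obtain ⟨Y, hY⟩ := exists_mem_posDual_pairing_ne_zero (q := q) hR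
  have hY' : Y ∈ weightedDensities F t T (maxDualVars F q t T M R) := by
    rw [weightedDensities_maxDualVars ht hFT hM hR]
    exact hY
  obtain ⟨z, hz, -⟩ := hY'
  exact ⟨z, hz⟩

theorem isDualRepresentation_maxDualVars (ht : t ≤ T) (hFT : F T = m0)
    (hM : M ≤ LpSub μ F d p t) (hR : IsClosedCoherentCondRiskMeasure M R) :
    IsDualRepresentation F t T M R (maxDualVars F q t T M R) := by
  rw [isDualRepresentation_iff ht hM (fun z hz => hz.1) (maxDualVars_nonempty ht hFT hM hR),
    weightedDensities_maxDualVars ht hFT hM hR]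
  exact eq_polarRM hR

theorem subset_maxDualVars (ht : t ≤ T) (hM : M ≤ LpSub μ F d p t)
    {W : Set ((Fin d → Measure Ω) × Lp (Vec d) q μ)} (hW : W ⊆ dualVars F q t T M)
    (hR : IsDualRepresentation F t T M R W) : W ⊆ maxDualVars F q t T M R := by
  intro z hz
  obtain ⟨Y, hY, hYz⟩ := (hW hz).2.2
  refine ⟨hW hz, Y, fun X hX => ?_, hYz⟩
  -- At `u = 0` the half-space condition reads `E[Yᵀ X] ≥ 0`, which is membership in the dual cone.
  have h0 : (0 : Lp (Vec d) p μ) ∈ R X := hX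
  rw [(isDualRepresentation_iff ht hM hW ⟨z, hz⟩).1 hR] at h0
  simpa only [pairing_zero, add_zero] using h0.2 Y ⟨z, hz, hYz⟩

end Representation

end Main

end SetRisk
end

theorem mainTheorem3 {Ω : Type*} [m0 : MeasurableSpace Ω] (μ : Measure Ω) [IsProbabilityMeasure μ]
    (T : ℕ) (F : Filtration ℕ m0) (hFT : F T = m0) (t : ℕ) (ht : t ≤ T) (d : ℕ)
    (p q : ℝ≥0∞) [Fact (1 ≤ p)] (hpq : 1 / p + 1 / q = 1)
    (M : Submodule ℝ (Lp (Vec d) p μ)) (hM : M ≤ SetRisk.LpSub μ F d p t)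
    (hMclosed : @IsClosed _ (SetRisk.LpTop μ d p) (M : Set (Lp (Vec d) p μ)))
    (hMpos : SetRisk.posPart M ≠ {0})
    (R : Lp (Vec d) p μ → Set (Lp (Vec d) p μ))
    (hR : ∀ X, R X ∈ SetRisk.ClosedConvexUpperSets M) :
    (SetRisk.IsClosedCoherentCondRiskMeasure M R ↔
      ∃ W : Set ((Fin d → Measure Ω) × Lp (Vec d) q μ),
        W ⊆ SetRisk.dualVars F q t T M ∧ W.Nonempty ∧
          SetRisk.IsDualRepresentation F t T M R W) ∧
    (SetRisk.IsClosedCoherentCondRiskMeasure M R →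
      (SetRisk.maxDualVars F q t T M R).Nonempty ∧
        SetRisk.IsDualRepresentation F t T M R (SetRisk.maxDualVars F q t T M R)) ∧
    (∀ W : Set ((Fin d → Measure Ω) × Lp (Vec d) q μ),
      W ⊆ SetRisk.dualVars F q t T M → SetRisk.IsDualRepresentation F t T M R W →
        W ⊆ SetRisk.maxDualVars F q t T M R) := by
  have : ENNReal.HolderConjugate q p :=
    ENNReal.holderConjugate_iff.2 (by rwa [one_div, one_div, add_comm] at hpq)
  have : Fact (1 ≤ q) := ⟨ENNReal.HolderConjugate.one_le q p⟩
  have hmax : SetRisk.IsClosedCoherentCondRiskMeasure M R →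
      (SetRisk.maxDualVars F q t T M R).Nonempty ∧
        SetRisk.IsDualRepresentation F t T M R (SetRisk.maxDualVars F q t T M R) := fun h =>
    ⟨SetRisk.maxDualVars_nonempty ht hFT hM h, SetRisk.isDualRepresentation_maxDualVars ht hFT hM h⟩
  refine ⟨⟨fun h => ⟨_, fun z hz => hz.1, hmax h⟩, ?_⟩, hmax, fun W hW hWR =>
    SetRisk.subset_maxDualVars ht hM hW hWR⟩
  rintro ⟨W, hW, hWne, hWR⟩
  exact SetRisk.isClosedCoherent_of_isDualRepresentation ht hM hMclosed hW hWne hWR
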